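/- Let $n\ge 1$, let $a_1,\dots,a_{2n}>1$ be distinct real numbers, and let $\eta\ge 0$ and $d\ge 1$ be integers. Let $B_2,B_3,B_4$ be the real $n\times 2n$ matrices whose entries in row $i$ and column $j$ ($1\le i\le n$, $1\le j\le 2n$) are $$(B_2)_{ij}=a_j^{\eta+(i-1)d},\qquad (B_3)_{ij}=a_j^{\eta+(n+i-1)d},\qquad (B_4)_{ij}=a_j^{\eta+(2n+i-1)d}.$$ For all real $C,R$ and $\delta>0$ there is an $\varepsilon_0>0$, depending only on $n,\eta,d,a_1,\dots,a_{2n},C,R,\delta$, with the following property. Let $n-\varepsilon_0<\alpha<n$ and $n/2<\beta<n$. Let $E\subset\mathbb R^n$ be a set of Lebesgue measure $0$, with any two points of $E$ at distance at most $R$, and let $\mu$ be a finite Borel measure on $\mathbb R^n$ with $\operatorname{supp}\mu\subseteq E$ and $\mu(\mathbb R^n)\ge\delta$ such that (a) $\mu(B(x;r))\le C\,r^{\alpha}$ for all $x\in E$ and all $0<r<1$; (b) $|\widehat\mu(\xi)|\,(1+|\xi|)^{\beta/2}\le C$ for all $\xi\in\mathbb R^n$, where $\widehat\mu(\xi)=\int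 e^{-2\pi i x\cdot\xi}\,d\mu(x)$. Then there are $x\in\mathbb R^n$ and $y\in\mathbb R^{2n}$ such that $x,\ x+B_2y,\ x+B_3y,\ x+B_4y$ all lie in $E$, and $B_2y\ne 0$, $B_3y\neq 0$, $B_4y\ne 0$. (The case of a probability measure $\mu$ and $E\subseteq[0,1]^n$ is $\delta=1$, $R=\sqrt n$.) -/

import Mathlib

open MeasureTheory

noncomputable section

/-- The Fourier transform `ξ ↦ ∫ exp (-2 π i x · ξ) dμ(x)` of a measure on `ℝⁿ`. -/
def measureFourier {n : ℕ} (μ : Measure (EuclideanSpace ℝ (Fin n)))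
    (ξ : EuclideanSpace ℝ (Fin n)) : ℂ :=
  ∫ x, Complex.exp (-(2 * Real.pi * inner ℝ x ξ : ℝ) * Complex.I) ∂μ

/-- Ball condition: `μ (B(x; r)) ≤ C r ^ α` for all `x ∈ E` and `0 < r < 1`. -/
def BallCondition {n : ℕ} (E : Set (EuclideanSpace ℝ (Fin n)))
    (μ : Measure (EuclideanSpace ℝ (Fin n))) (α C : ℝ) : Prop :=
  ∀ x ∈ E, ∀ r : ℝ, 0 < r → r < 1 → μ.real (Metric.ball x r) / r ^ α ≤ C

/-- Fourier decay condition: `|μ̂ ξ| (1 + |ξ|) ^ (β / 2) ≤ C` for all `ξ`. -/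
def FourierDecay {n : ℕ} (μ : Measure (EuclideanSpace ℝ (Fin n))) (β C : ℝ) : Prop :=
  ∀ ξ : EuclideanSpace ℝ (Fin n), ‖measureFourier μ ξ‖ * (1 + ‖ξ‖) ^ (β / 2) ≤ C

/-- The `n × 2n` matrix with entries `a_j ^ (η + (s + i - 1) d)`, for `1 ≤ i ≤ n` and
`1 ≤ j ≤ 2n`; the row index `i : Fin n` below starts at `0`. -/
def vandermondeBlock {n : ℕ} (a : Fin (2 * n) → ℝ) (η d s : ℕ) :
    Matrix (Fin n) (Fin (2 * n)) ℝ :=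
  Matrix.of fun i j => a j ^ (η + (s + (i : ℕ)) * d)

/-- The linear map `ℝ²ⁿ → ℝⁿ`, `y ↦ B y`, between Euclidean spaces. -/
def applyMatrix {n : ℕ} (B : Matrix (Fin n) (Fin (2 * n)) ℝ)
    (y : EuclideanSpace ℝ (Fin (2 * n))) : EuclideanSpace ℝ (Fin n) :=
  WithLp.toLp 2 (B.mulVec y.ofLp)

end

/-! Write `t_j = a_j ^ d`. Any two of the three blocks stacked together form a generalized
Vandermonde matrix with distinct positive nodes, hence an invertible one (Descartes' rule of signs).
The displacements along the first two blocks are therefore arbitrary and determine the third. So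
four points form a configuration exactly when they satisfy one equation `w = S x + P y + Q z`, where
`S + P + Q = 1`. Injectivity of `P`, `Q` and `S` follows from the same nonsingularity; for `S` the
condition `a_j > 1` is needed.

It remains to solve such an equation nontrivially in the support of `μ`
(`exists_solution_in_support`). The argument is by compactness. If it fails, there are probability
measures `μ k` on a fixed ball, with ball exponents tending to the dimension and uniform constants,
whose supports contain no nontrivial solution. A weak limit `ν` of a subsequence satisfies a ball
condition of full dimension, so it dominates a multiple of Lebesgue measure on a compact set of
positive volume. Near a nondegenerate configuration in that set, bump functions localize the four
variables to separated balls, where every solution is nontrivial.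

Let `Λ m l` be the Gaussian average, at width about `2 ^ (-l)`, of the law of `S x + P y + Q z - w`
under the localized copies of `m`. Three facts conflict: (1) `Λ ν l` is bounded below uniformly in
`l`, by a Steinhaus argument. (2) `Λ (μ k) l` tends to `0` as `l` grows, because the law vanishes
near the origin. (3) `Λ (μ k) (l + 1) - Λ (μ k) l` is at most a geometric term uniform in `k`.
Pointwise Fourier decay of two factors beats the small loss in the L² bound of the other two, which
comes from the ball condition. By (2) and (3), `Λ (μ k) l` is at most a constant times `r ^ l`,
uniformly in `k`. Letting `k` tend to infinity transfers this to `ν`, contradicting (1). -/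

set_option linter.unusedSectionVars false

/-! ### Gaussian averages and characteristic functions. -/

section heat
open Real Complex ComplexConjugate
variable {V : Type*} [NormedAddCommGroup V] [InnerProductSpace ℝ V] [FiniteDimensional ℝ V]
  [MeasurableSpace V] [BorelSpace V]

/-- The Fourier transform of the Gaussian `exp (-b ‖ξ‖ ^ 2)`. -/
noncomputable def heatKernel (b : ℝ) (w : V) : ℝ :=
  (π / b) ^ (Module.finrank ℝ V / 2 : ℝ) * Real.exp (-‖w‖ ^ 2 / (4 * b))

lemma heatKernel_nonneg {b : ℝ} (hb : 0 < b) (w : V) : 0 ≤ heatKernel b w := by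
  unfold heatKernel; positivity

lemma continuous_heatKernel (b : ℝ) : Continuous (heatKernel b : V → ℝ) := by
  unfold heatKernel; fun_prop

lemma heatKernel_le {b : ℝ} (hb : 0 < b) (w : V) :
    heatKernel b w ≤ (π / b) ^ (Module.finrank ℝ V / 2 : ℝ) := by
  unfold heatKernel
  refine mul_le_of_le_one_right (by positivity) ?_
  rw [Real.exp_le_one_iff]
  rw [neg_div]
  have : 0 ≤ ‖w‖ ^ 2 / (4 * b) := by positivity
  linarith

lemma integrable_gaussian {b : ℝ} (hb : 0 < b) :
    Integrable (fun ξ : V => Real.exp (-b * ‖ξ‖ ^ 2)) := by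
  have := (GaussianFourier.integrable_cexp_neg_mul_sq_norm_add (V := V) (b := (b : ℂ))
    (by simpa using hb) 0 0).norm
  refine this.congr (Filter.Eventually.of_forall fun ξ => ?_)
  simp only [Complex.norm_exp]
  congr 1
  simp [← Complex.ofReal_pow]

lemma integral_gaussian_mul_char {b : ℝ} (hb : 0 < b) (w : V) :
    ∫ ξ : V, (Real.exp (-b * ‖ξ‖ ^ 2) : ℂ) * cexp (inner ℝ w ξ * I) = (heatKernel b w : ℂ) := by
  have h := GaussianFourier.integral_cexp_neg_mul_sq_norm_add (V := V) (b := (b : ℂ))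
    (by simpa using hb) I w
  have e1 : ∀ ξ : V, (Real.exp (-b * ‖ξ‖ ^ 2) : ℂ) * cexp (inner ℝ w ξ * I)
      = cexp (-b * ‖ξ‖ ^ 2 + I * inner ℝ w ξ) := by
    intro ξ
    rw [Complex.exp_add]
    push_cast
    rw [mul_comm I]
  simp_rw [e1]
  rw [h]
  unfold heatKernel
  rw [Complex.ofReal_mul, Complex.ofReal_cpow (by positivity)]
  push_cast
  congr 2
  rw [I_sq]; ring

/-- The Gaussian average of a characteristic function. -/
lemma integral_gaussian_mul_charFun {b : ℝ} (hb : 0 < b) (θ : Measure V) [IsFiniteMeasure θ] :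
    ∫ ξ : V, (Real.exp (-b * ‖ξ‖ ^ 2) : ℂ) * charFun θ ξ = ((∫ w, heatKernel b w ∂θ : ℝ) : ℂ) := by
  have hint : Integrable (fun p : V × V => (Real.exp (-b * ‖p.1‖ ^ 2) : ℂ) *
      cexp (inner ℝ p.2 p.1 * I)) (volume.prod θ) := by
    have h1 : Integrable (fun p : V × V => (Real.exp (-b * ‖p.1‖ ^ 2) : ℂ)) (volume.prod θ) := by
      have := (integrable_gaussian (V := V) hb).ofReal (𝕜 := ℂ)
      exact this.comp_fst θ
    refine h1.mul_bdd (c := 1) (by fun_prop) (Filter.Eventually.of_forall fun p => ?_)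
    rw [Complex.norm_exp_ofReal_mul_I]
  simp_rw [charFun_apply, ← integral_const_mul]
  rw [integral_integral_swap hint]
  simp_rw [integral_gaussian_mul_char hb]
  exact integral_ofReal
end heat

/-! ### L² bounds for characteristic functions from the ball condition. -/

section energy
open Real Complex ComplexConjugate
variable {V : Type*} [NormedAddCommGroup V] [InnerProductSpace ℝ V] [FiniteDimensional ℝ V]
  [MeasurableSpace V] [BorelSpace V]

/-- This turns the Gaussian-weighted L² norm of `charFun m` into a double integral of the heat
kernel over differences, which the ball condition controls. -/
lemma charFun_map_sub (m : Measure V) [IsFiniteMeasure m] (ξ : V) :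
    charFun ((m.prod m).map (fun p : V × V => p.1 - p.2)) ξ = ((‖charFun m ξ‖ ^ 2 : ℝ) : ℂ) := by
  rw [charFun_apply, integral_map (by fun_prop) (by fun_prop)]
  have : ∀ p : V × V, cexp (inner ℝ (p.1 - p.2) ξ * I)
      = cexp (inner ℝ p.1 ξ * I) * cexp (inner ℝ p.2 (-ξ) * I) := by
    intro p
    rw [← Complex.exp_add, inner_sub_left, inner_neg_right]
    push_cast; ring_nf
  simp_rw [this]
  rw [integral_prod_mul (fun x : V => cexp (inner ℝ x ξ * I))
    (fun x : V => cexp (inner ℝ x (-ξ) * I)), ← charFun_apply, ← charFun_apply, charFun_neg,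
    Complex.mul_conj, Complex.normSq_eq_norm_sq]

/-- The constant in the bound for Gaussian averages of measures satisfying a ball condition. -/
noncomputable def gaussShellSum (d : ℕ) : ℝ :=
  ∑' k : ℕ, Real.exp 2 * ((k + 1 : ℕ) ^ d * Real.exp (-(1 : ℝ) * (k + 1 : ℕ)))

lemma summable_gaussShellSum (d : ℕ) : Summable fun k : ℕ =>
    Real.exp 2 * (((k + 1 : ℕ) : ℝ) ^ d * Real.exp (-(1 : ℝ) * (k + 1 : ℕ))) :=
  ((summable_nat_add_iff 1).2 (Real.summable_pow_mul_exp_neg_nat_mul d one_pos)).mul_left _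

lemma gaussShellSum_nonneg (d : ℕ) : 0 ≤ gaussShellSum d := tsum_nonneg fun _ => by positivity

/-- The term `k = ⌊s⌋₊` alone suffices, since `(s - 2) ^ 2 ≥ 0` gives `-s ^ 2 / 4 ≤ 1 - s ≤ 2 - (k +
1)`. Indicators of balls replace the Gaussian so that ball bounds can be summed. -/
lemma exp_neg_sq_le_tsum {s : ℝ} (hs : 0 ≤ s) :
    ENNReal.ofReal (Real.exp (-s ^ 2 / 4)) ≤ ∑' k : ℕ,
      ENNReal.ofReal (Real.exp 2 * Real.exp (-(1 : ℝ) * (k + 1 : ℕ))) *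
        (Set.Iic ((k + 1 : ℕ) : ℝ)).indicator 1 s := by
  refine le_trans ?_ (ENNReal.le_tsum ⌊s⌋₊)
  have h1 : s ≤ ((⌊s⌋₊ + 1 : ℕ) : ℝ) := by push_cast; exact (Nat.lt_floor_add_one s).le
  have h2 : (⌊s⌋₊ : ℝ) ≤ s := Nat.floor_le hs
  rw [Set.indicator_of_mem (by exact h1), Pi.one_apply, mul_one, ← Real.exp_add]
  refine ENNReal.ofReal_le_ofReal (Real.exp_le_exp.2 ?_)
  push_cast
  nlinarith [sq_nonneg (s - 2)]

/-- The kernel has width about `√b`. Cover by balls of radius `(k + 1) √b`: each has mass at most `A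
(k + 1) ^ α b ^ (α / 2)`, and the exponential weights make the sum converge. -/
lemma lintegral_heatKernel_sub_le (m : Measure V) [IsFiniteMeasure m] {A α b : ℝ} (hA : 0 ≤ A)
    (hα : α ≤ Module.finrank ℝ V) (hb : 0 < b)
    (hball : ∀ x r, 0 < r → m.real (Metric.closedBall x r) ≤ A * r ^ α) (x : V) :
    ∫⁻ y, ENNReal.ofReal (heatKernel b (y - x)) ∂m ≤
      ENNReal.ofReal ((π / b) ^ (Module.finrank ℝ V / 2 : ℝ) *
        (A * b ^ (α / 2) * gaussShellSum (Module.finrank ℝ V))) := by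
  unfold heatKernel
  set d := Module.finrank ℝ V with hd
  simp_rw [ENNReal.ofReal_mul (show 0 ≤ (π / b) ^ (d / 2 : ℝ) by positivity)]
  rw [lintegral_const_mul _ (by fun_prop)]
  gcongr
  have hsb : 0 < √b := Real.sqrt_pos.2 hb
  calc ∫⁻ y, ENNReal.ofReal (Real.exp (-‖y - x‖ ^ 2 / (4 * b))) ∂m
      ≤ ∫⁻ y, ∑' k : ℕ, ENNReal.ofReal (Real.exp 2 * Real.exp (-(1 : ℝ) * (k + 1 : ℕ))) *
        (Metric.closedBall x ((k + 1 : ℕ) * √b)).indicator 1 y ∂m := by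
        refine lintegral_mono fun y => ?_
        have := exp_neg_sq_le_tsum (s := ‖y - x‖ / √b) (by positivity)
        have e : -(‖y - x‖ / √b) ^ 2 / 4 = -‖y - x‖ ^ 2 / (4 * b) := by
          rw [div_pow, Real.sq_sqrt hb.le]; field_simp
        rw [e] at this
        refine this.trans (ENNReal.tsum_le_tsum fun k => ?_)
        gcongr
        by_cases h : ‖y - x‖ / √b ≤ ((k + 1 : ℕ) : ℝ)
        · rw [Set.indicator_of_mem (by exact h), Set.indicator_of_mem]
          · exact le_rfl
          · rw [Metric.mem_closedBall, dist_eq_norm]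
            exact (div_le_iff₀ hsb).1 h
        · rw [Set.indicator_of_notMem (by exact h)]; exact zero_le
    _ = ∑' k : ℕ, ENNReal.ofReal (Real.exp 2 * Real.exp (-(1 : ℝ) * (k + 1 : ℕ))) *
        m (Metric.closedBall x ((k + 1 : ℕ) * √b)) := by
        rw [lintegral_tsum]
        · congr 1; ext k
          rw [lintegral_const_mul _ (measurable_one.indicator Metric.isClosed_closedBall.measurableSet),
            lintegral_indicator_one Metric.isClosed_closedBall.measurableSet]
        · intro k
          exact ((measurable_one.indicator Metric.isClosed_closedBall.measurableSet).const_mul _).aemeasurable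
    _ ≤ ∑' k : ℕ, ENNReal.ofReal (A * b ^ (α / 2)) * ENNReal.ofReal (Real.exp 2 *
          (((k + 1 : ℕ) : ℝ) ^ d * Real.exp (-(1 : ℝ) * (k + 1 : ℕ)))) := by
        refine ENNReal.tsum_le_tsum fun k => ?_
        rw [← ENNReal.ofReal_toReal (measure_ne_top m (Metric.closedBall x _)),
          ← ENNReal.ofReal_mul (by positivity), ← ENNReal.ofReal_mul (by positivity)]
        refine ENNReal.ofReal_le_ofReal ?_
        have h1 := hball x ((k + 1 : ℕ) * √b) (by positivity)
        rw [Real.mul_rpow (by positivity) hsb.le] at h1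
        have h2 : √b ^ α = b ^ (α / 2) := by
          rw [Real.sqrt_eq_rpow, ← Real.rpow_mul hb.le]; congr 1; ring
        have h3 : ((k + 1 : ℕ) : ℝ) ^ α ≤ ((k + 1 : ℕ) : ℝ) ^ d := by
          rw [← Real.rpow_natCast]
          exact Real.rpow_le_rpow_of_exponent_le (by push_cast; linarith [Nat.cast_nonneg (α := ℝ) k]) hα
        rw [h2] at h1
        calc _ ≤ Real.exp 2 * Real.exp (-(1 : ℝ) * (k + 1 : ℕ)) *
              (A * (((k + 1 : ℕ) : ℝ) ^ d * b ^ (α / 2))) := by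
              refine mul_le_mul_of_nonneg_left (h1.trans ?_) (by positivity)
              gcongr
          _ = _ := by ring
    _ = ENNReal.ofReal (A * b ^ (α / 2) * gaussShellSum d) := by
        rw [ENNReal.tsum_mul_left, ← ENNReal.ofReal_tsum_of_nonneg (fun _ => by positivity)
          (summable_gaussShellSum d), ← ENNReal.ofReal_mul (by positivity)]
        rfl

lemma integral_gaussian_mul_sq_charFun_le (m : Measure V) [IsFiniteMeasure m] {A α b : ℝ}
    (hA : 0 ≤ A) (hα : α ≤ Module.finrank ℝ V) (hb : 0 < b)
    (hball : ∀ x r, 0 < r → m.real (Metric.closedBall x r) ≤ A * r ^ α) :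
    ∫ ξ : V, Real.exp (-b * ‖ξ‖ ^ 2) * ‖charFun m ξ‖ ^ 2 ≤
      (π / b) ^ (Module.finrank ℝ V / 2 : ℝ) *
        (A * b ^ (α / 2) * gaussShellSum (Module.finrank ℝ V)) * m.real Set.univ := by
  have h := integral_gaussian_mul_charFun hb ((m.prod m).map (fun p : V × V => p.1 - p.2))
  simp_rw [charFun_map_sub, ← Complex.ofReal_mul] at h
  replace h : ∫ ξ : V, Real.exp (-b * ‖ξ‖ ^ 2) * ‖charFun m ξ‖ ^ 2 = _ :=
    Complex.ofReal_injective (integral_ofReal.symm.trans h)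
  rw [h, integral_eq_lintegral_of_nonneg_ae (Filter.Eventually.of_forall fun w => heatKernel_nonneg hb w)
    (continuous_heatKernel b).aestronglyMeasurable]
  refine ENNReal.toReal_le_of_le_ofReal ?_ ?_
  · have := gaussShellSum_nonneg (Module.finrank ℝ V); positivity
  rw [lintegral_map (by have := continuous_heatKernel (V := V) b; fun_prop) (by fun_prop),
    lintegral_prod_symm' _ (by have := continuous_heatKernel (V := V) b; fun_prop)]
  refine (lintegral_mono fun x => lintegral_heatKernel_sub_le m hA hα hb hball x).trans ?_
  rw [lintegral_const, ← ofReal_measureReal (μ := m), ← ENNReal.ofReal_mul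
    (by have := gaussShellSum_nonneg (Module.finrank ℝ V); positivity)]
end energy

/-! ### The law of the linear relation and its behaviour across dyadic scales. -/

section form
open Real Complex ComplexConjugate
variable {V : Type*} [NormedAddCommGroup V] [InnerProductSpace ℝ V] [FiniteDimensional ℝ V]
  [MeasurableSpace V] [BorelSpace V]

/-- The law of `S x + P y + Q z - w` under the product measure `m₁ × m₂ × m₃ × m₄`. -/
noncomputable def relationLaw (S P Q : V →L[ℝ] V) (m₁ m₂ m₃ m₄ : Measure V) : Measure V :=
  (m₁.prod (m₂.prod (m₃.prod m₄))).map
    fun z => S z.1 + P z.2.1 + Q z.2.2.1 - z.2.2.2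

instance (S P Q : V →L[ℝ] V) (m₁ m₂ m₃ m₄ : Measure V) [IsFiniteMeasure m₁] [IsFiniteMeasure m₂]
    [IsFiniteMeasure m₃] [IsFiniteMeasure m₄] : IsFiniteMeasure (relationLaw S P Q m₁ m₂ m₃ m₄) := by
  unfold relationLaw; infer_instance

lemma charFun_map_clm (S : V →L[ℝ] V) (m : Measure V) (ξ : V) :
    charFun (m.map S) ξ = ∫ x, cexp (inner ℝ (S x) ξ * I) ∂m := by
  rw [charFun_apply, integral_map (by fun_prop) (by fun_prop)]

lemma charFun_relationLaw (S P Q : V →L[ℝ] V) (m₁ m₂ m₃ m₄ : Measure V) [IsFiniteMeasure m₁]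
    [IsFiniteMeasure m₂] [IsFiniteMeasure m₃] [IsFiniteMeasure m₄] (ξ : V) :
    charFun (relationLaw S P Q m₁ m₂ m₃ m₄) ξ = charFun (m₁.map S) ξ * (charFun (m₂.map P) ξ *
      (charFun (m₃.map Q) ξ * charFun m₄ (-ξ))) := by
  unfold relationLaw
  rw [charFun_apply, integral_map (by fun_prop) (by fun_prop)]
  have : ∀ z : V × V × V × V, cexp (inner ℝ (S z.1 + P z.2.1 + Q z.2.2.1 - z.2.2.2) ξ * I)
      = cexp (inner ℝ (S z.1) ξ * I) * (cexp (inner ℝ (P z.2.1) ξ * I) *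
        (cexp (inner ℝ (Q z.2.2.1) ξ * I) * cexp (inner ℝ z.2.2.2 (-ξ) * I))) := by
    intro z
    simp only [← Complex.exp_add, inner_sub_left, inner_add_left, inner_neg_right]
    push_cast; ring_nf
  simp_rw [this, charFun_map_clm]
  rw [integral_prod_mul (fun x : V => cexp (inner ℝ (S x) ξ * I)) (fun x : V × V × V =>
      (cexp (inner ℝ (P x.1) ξ * I) * (cexp (inner ℝ (Q x.2.1) ξ * I) *
        cexp (inner ℝ x.2.2 (-ξ) * I)))),
    integral_prod_mul (fun x : V => cexp (inner ℝ (P x) ξ * I)) (fun x : V × V =>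
      (cexp (inner ℝ (Q x.1) ξ * I) * cexp (inner ℝ x.2 (-ξ) * I))),
    integral_prod_mul (fun x : V => cexp (inner ℝ (Q x) ξ * I)) (fun x : V =>
      cexp (inner ℝ x (-ξ) * I))]
  rfl

/-- With `s = b ‖ξ‖ ^ 2` the exponent `1 / 4` gains `b ^ (1 / 4)` at the price of `‖ξ‖ ^ (1 / 2)`,
which two factors of decay `1 / 4` can pay. -/
lemma abs_exp_sub_exp_le {s : ℝ} (hs : 0 ≤ s) :
    |Real.exp (-s / 4) - Real.exp (-s)| ≤ Real.exp (-s / 4) * s ^ (1 / 4 : ℝ) := by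
  have h0 : Real.exp (-s) = Real.exp (-s / 4) * Real.exp (-(3 * s / 4)) := by
    rw [← Real.exp_add]; ring_nf
  have h1 : Real.exp (-(3 * s / 4)) ≤ 1 := Real.exp_le_one_iff.2 (by linarith)
  have h2 : 1 - Real.exp (-(3 * s / 4)) ≤ s ^ (1 / 4 : ℝ) := by
    rcases le_total s 1 with h | h
    · have := Real.add_one_le_exp (-(3 * s / 4))
      have h3 : s ^ (1 : ℝ) ≤ s ^ (1 / 4 : ℝ) :=
        Real.rpow_le_rpow_of_exponent_ge' hs h (by norm_num) (by norm_num)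
      rw [Real.rpow_one] at h3
      linarith
    · have := Real.one_le_rpow h (show (0 : ℝ) ≤ 1 / 4 by norm_num)
      have := Real.exp_pos (-(3 * s / 4))
      linarith
  rw [h0, ← mul_one_sub, abs_of_nonneg (mul_nonneg (Real.exp_pos _).le (by linarith))]
  gcongr

lemma abs_integral_heatKernel_sub_le {b : ℝ} (hb : 0 < b) (θ : Measure V) [IsFiniteMeasure θ]
    (h : V → ℝ) (hint : Integrable fun ξ => Real.exp (-(b / 4) * ‖ξ‖ ^ 2) * h ξ)
    (hθ : ∀ ξ, ‖charFun θ ξ‖ * (1 + ‖ξ‖) ^ (1 / 2 : ℝ) ≤ h ξ) :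
    |∫ w, heatKernel (b / 4) w ∂θ - ∫ w, heatKernel b w ∂θ| ≤
      b ^ (1 / 4 : ℝ) * ∫ ξ, Real.exp (-(b / 4) * ‖ξ‖ ^ 2) * h ξ := by
  have hI : ∀ c : ℝ, 0 < c → Integrable fun ξ : V => (Real.exp (-c * ‖ξ‖ ^ 2) : ℂ) * charFun θ ξ := by
    intro c hc
    refine (integrable_gaussian (V := V) hc).ofReal.mul_bdd (c := θ.real Set.univ) ?_
      (Filter.Eventually.of_forall fun ξ => norm_charFun_le ξ)
    exact (stronglyMeasurable_charFun).aestronglyMeasurable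
  have hb4 : 0 < b / 4 := by positivity
  rw [← Real.norm_eq_abs, ← Complex.norm_real, Complex.ofReal_sub, ← integral_gaussian_mul_charFun hb4,
    ← integral_gaussian_mul_charFun hb, ← integral_sub (hI _ hb4) (hI _ hb), ← integral_const_mul]
  refine norm_integral_le_of_norm_le (hint.const_mul _) (Filter.Eventually.of_forall fun ξ => ?_)
  rw [← sub_mul, norm_mul, ← Complex.ofReal_sub, Complex.norm_real, Real.norm_eq_abs]
  have h1 := abs_exp_sub_exp_le (s := b * ‖ξ‖ ^ 2) (by positivity)
  have e1 : -(b * ‖ξ‖ ^ 2) / 4 = -(b / 4) * ‖ξ‖ ^ 2 := by ring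
  have e2 : -(b * ‖ξ‖ ^ 2) = -b * ‖ξ‖ ^ 2 := by ring
  have e3 : (b * ‖ξ‖ ^ 2) ^ (1 / 4 : ℝ) ≤ b ^ (1 / 4 : ℝ) * (1 + ‖ξ‖) ^ (1 / 2 : ℝ) := by
    rw [Real.mul_rpow hb.le (by positivity), ← Real.rpow_natCast, ← Real.rpow_mul (norm_nonneg _)]
    norm_num
    gcongr
    linarith
  rw [e1, e2] at h1
  calc _ ≤ Real.exp (-(b / 4) * ‖ξ‖ ^ 2) * (b ^ (1 / 4 : ℝ) * (1 + ‖ξ‖) ^ (1 / 2 : ℝ)) *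
        ‖charFun θ ξ‖ := by gcongr; exact h1.trans (by gcongr)
    _ = b ^ (1 / 4 : ℝ) * (Real.exp (-(b / 4) * ‖ξ‖ ^ 2) *
        (‖charFun θ ξ‖ * (1 + ‖ξ‖) ^ (1 / 2 : ℝ))) := by ring
    _ ≤ _ := by gcongr; exact hθ ξ

/-- Successive dyadic Gaussian averages of a relation law differ by a geometric amount. -/
lemma abs_integral_heatKernel_relationLaw_sub_le (S P Q : V →L[ℝ] V) (m₁ m₂ m₃ m₄ : Measure V)
    [IsFiniteMeasure m₁] [IsFiniteMeasure m₂] [IsFiniteMeasure m₃] [IsFiniteMeasure m₄]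
    {D A α : ℝ} (hA : 0 ≤ A) (hα : α ≤ Module.finrank ℝ V) (hα' : Module.finrank ℝ V - 1 / 4 ≤ α)
    (h₁ : ∀ ξ, ‖charFun (m₁.map S) ξ‖ * (1 + ‖ξ‖) ^ (1 / 4 : ℝ) ≤ D)
    (h₂ : ∀ ξ, ‖charFun (m₂.map P) ξ‖ * (1 + ‖ξ‖) ^ (1 / 4 : ℝ) ≤ D)
    (h₃ : ∀ x r, 0 < r → (m₃.map Q).real (Metric.closedBall x r) ≤ A * r ^ α)
    (h₄ : ∀ x r, 0 < r → m₄.real (Metric.closedBall x r) ≤ A * r ^ α)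
    (hm₃ : m₃.real Set.univ ≤ 1) (hm₄ : m₄.real Set.univ ≤ 1) (l : ℕ) :
    |∫ w, heatKernel ((1 / 4) ^ (l + 1)) w ∂(relationLaw S P Q m₁ m₂ m₃ m₄) -
        ∫ w, heatKernel ((1 / 4) ^ l) w ∂(relationLaw S P Q m₁ m₂ m₃ m₄)| ≤
      (2 * D ^ 2 * (π ^ (Module.finrank ℝ V / 2 : ℝ) * A * gaussShellSum (Module.finrank ℝ V)) *
        4 ^ (1 / 8 : ℝ)) * ((1 / 4 : ℝ) ^ (1 / 8 : ℝ)) ^ l := by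
  set d := Module.finrank ℝ V with hd
  set b : ℝ := (1 / 4) ^ l with hbdef
  have hb : 0 < b := by positivity
  have hb1 : b ≤ 1 := pow_le_one₀ (by norm_num) (by norm_num)
  have hb4 : 0 < b / 4 := by positivity
  have hG := gaussShellSum_nonneg d
  have hD : 0 ≤ D := le_trans (by positivity) (h₁ 0)
  have e : ((1 : ℝ) / 4) ^ (l + 1) = b / 4 := by rw [pow_succ]; ring
  rw [e]
  have hI : ∀ (m : Measure V) [IsFiniteMeasure m],
      Integrable fun ξ : V => Real.exp (-(b / 4) * ‖ξ‖ ^ 2) * ‖charFun m ξ‖ ^ 2 := by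
    intro m _
    refine (integrable_gaussian (V := V) hb4).mul_bdd (c := m.real Set.univ ^ 2) ?_
      (Filter.Eventually.of_forall fun ξ => ?_)
    · exact ((stronglyMeasurable_charFun (μ := m)).norm.pow 2).aestronglyMeasurable
    · rw [norm_pow, norm_norm]
      gcongr
      exact norm_charFun_le ξ
  have hL2 : ∀ (m : Measure V) [IsFiniteMeasure m], m.real Set.univ ≤ 1 →
      (∀ x r, 0 < r → m.real (Metric.closedBall x r) ≤ A * r ^ α) →
      ∫ ξ : V, Real.exp (-(b / 4) * ‖ξ‖ ^ 2) * ‖charFun m ξ‖ ^ 2 ≤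
        (π ^ (d / 2 : ℝ) * A * gaussShellSum d) * (4 ^ (1 / 8 : ℝ) * b ^ (-(1 / 8) : ℝ)) := by
    intro m _ hm hball
    refine (integral_gaussian_mul_sq_charFun_le m hA hα hb4 hball).trans ?_
    rw [← hd, Real.div_rpow pi_pos.le hb4.le]
    -- Since `α ≥ d - 1 / 4`, the L² bound loses only `b ^ (-1 / 8)`, less than the gain `b ^ (1 /
    -- 4)`; the net factor `b ^ (1 / 8)` is geometric in `l`.
    have h5 : (b / 4) ^ (α / 2) / (b / 4) ^ (d / 2 : ℝ) ≤ 4 ^ (1 / 8 : ℝ) * b ^ (-(1 / 8) : ℝ) := by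
      rw [← Real.rpow_sub hb4]
      calc (b / 4) ^ (α / 2 - d / 2) ≤ (b / 4) ^ (-(1 / 8) : ℝ) :=
            Real.rpow_le_rpow_of_exponent_ge hb4 (by linarith) (by linarith)
        _ = _ := by
            rw [Real.div_rpow hb.le (by norm_num), Real.rpow_neg (by norm_num : (0 : ℝ) ≤ 4),
              div_inv_eq_mul, mul_comm]
    calc _ = (π ^ (d / 2 : ℝ) * A * gaussShellSum d) *
          ((b / 4) ^ (α / 2) / (b / 4) ^ (d / 2 : ℝ)) * m.real Set.univ := by ring
      _ ≤ (π ^ (d / 2 : ℝ) * A * gaussShellSum d) * (4 ^ (1 / 8 : ℝ) * b ^ (-(1 / 8) : ℝ)) * 1 := by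
          gcongr
      _ = _ := mul_one _
  have hfin : IsFiniteMeasure (m₃.map Q) := inferInstance
  have hm₃' : (m₃.map Q).real Set.univ ≤ 1 := by
    rwa [map_measureReal_apply (by fun_prop) MeasurableSet.univ, Set.preimage_univ]
  refine (abs_integral_heatKernel_sub_le hb _
    (fun ξ => D ^ 2 * (‖charFun (m₃.map Q) ξ‖ ^ 2 + ‖charFun m₄ ξ‖ ^ 2)) ?_ ?_).trans ?_
  · simp_rw [mul_left_comm _ (D ^ 2), mul_add]
    exact ((hI _).const_mul _).add ((hI _).const_mul _)
  · intro ξ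
    rw [charFun_relationLaw, charFun_neg]
    simp only [norm_mul, RCLike.norm_conj]
    have e2 : (1 + ‖ξ‖) ^ (1 / 2 : ℝ) = (1 + ‖ξ‖) ^ (1 / 4 : ℝ) * (1 + ‖ξ‖) ^ (1 / 4 : ℝ) := by
      rw [← Real.rpow_add (by positivity)]; norm_num
    rw [e2]
    calc _ = (‖charFun (m₁.map S) ξ‖ * (1 + ‖ξ‖) ^ (1 / 4 : ℝ)) *
          (‖charFun (m₂.map P) ξ‖ * (1 + ‖ξ‖) ^ (1 / 4 : ℝ)) *
          (‖charFun (m₃.map Q) ξ‖ * ‖charFun m₄ ξ‖) := by ring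
      _ ≤ D * D * (‖charFun (m₃.map Q) ξ‖ ^ 2 + ‖charFun m₄ ξ‖ ^ 2) := by
          gcongr
          · exact h₁ ξ
          · exact h₂ ξ
          · nlinarith [sq_nonneg (‖charFun (m₃.map Q) ξ‖ - ‖charFun m₄ ξ‖),
              sq_nonneg (‖charFun (m₃.map Q) ξ‖), sq_nonneg (‖charFun m₄ ξ‖)]
      _ = _ := by ring
  · have e3 : ∀ ξ : V, Real.exp (-(b / 4) * ‖ξ‖ ^ 2) *
        (D ^ 2 * (‖charFun (m₃.map Q) ξ‖ ^ 2 + ‖charFun m₄ ξ‖ ^ 2)) =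
        D ^ 2 * (Real.exp (-(b / 4) * ‖ξ‖ ^ 2) * ‖charFun (m₃.map Q) ξ‖ ^ 2 +
          Real.exp (-(b / 4) * ‖ξ‖ ^ 2) * ‖charFun m₄ ξ‖ ^ 2) := fun ξ => by ring
    simp_rw [e3]
    rw [integral_const_mul, integral_add (hI _) (hI _)]
    have h6 := hL2 (m₃.map Q) hm₃' h₃
    have h7 := hL2 m₄ hm₄ h₄
    have e4 : b ^ (1 / 4 : ℝ) * b ^ (-(1 / 8) : ℝ) = ((1 / 4 : ℝ) ^ (1 / 8 : ℝ)) ^ l := by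
      rw [← Real.rpow_add hb, hbdef, ← Real.rpow_natCast, ← Real.rpow_natCast,
        ← Real.rpow_mul (by norm_num), ← Real.rpow_mul (by norm_num)]
      congr 1; ring
    calc _ ≤ b ^ (1 / 4 : ℝ) * (D ^ 2 *
          ((π ^ (d / 2 : ℝ) * A * gaussShellSum d) * (4 ^ (1 / 8 : ℝ) * b ^ (-(1 / 8) : ℝ)) +
          (π ^ (d / 2 : ℝ) * A * gaussShellSum d) * (4 ^ (1 / 8 : ℝ) * b ^ (-(1 / 8) : ℝ)))) := by
          gcongr
      _ = 2 * D ^ 2 * (π ^ (d / 2 : ℝ) * A * gaussShellSum d) * 4 ^ (1 / 8 : ℝ) *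
          (b ^ (1 / 4 : ℝ) * b ^ (-(1 / 8) : ℝ)) := by ring
      _ = _ := by rw [e4]
end form

/-! ### Stability of the hypotheses under localization and linear maps. -/

section decay
open Real Complex ComplexConjugate FourierTransform
variable {V : Type*} [NormedAddCommGroup V] [InnerProductSpace ℝ V] [FiniteDimensional ℝ V]
  [MeasurableSpace V] [BorelSpace V]

/-- The measure with density `f` with respect to `μ`, for a real function `f`. -/
noncomputable def weightedMeasure (f : V → ℝ) (μ : Measure V) : Measure V :=
  μ.withDensity fun x => ENNReal.ofReal (f x)

lemma weightedMeasure_le {f : V → ℝ} (hf : ∀ x, f x ≤ 1) (μ : Measure V) :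
    weightedMeasure f μ ≤ μ := by
  calc weightedMeasure f μ ≤ μ.withDensity 1 :=
        withDensity_mono (Filter.Eventually.of_forall fun x => by simpa using hf x)
    _ = μ := withDensity_one

lemma isFiniteMeasure_weightedMeasure {f : V → ℝ} (hf : ∀ x, f x ≤ 1) (μ : Measure V)
    [IsFiniteMeasure μ] : IsFiniteMeasure (weightedMeasure f μ) :=
  isFiniteMeasure_of_le μ (weightedMeasure_le hf μ)

lemma weightedMeasure_real_le {f : V → ℝ} (hf : ∀ x, f x ≤ 1) (μ : Measure V)
    [IsFiniteMeasure μ] (s : Set V) : (weightedMeasure f μ).real s ≤ μ.real s :=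
  ENNReal.toReal_mono (measure_ne_top _ _) (weightedMeasure_le hf μ s)

lemma charFun_weightedMeasure {f : V → ℝ} (hf : Continuous f) (hf0 : ∀ x, 0 ≤ f x)
    (μ : Measure V) (ξ : V) :
    charFun (weightedMeasure f μ) ξ = ∫ x, (f x : ℂ) * cexp (inner ℝ x ξ * I) ∂μ := by
  unfold weightedMeasure
  rw [charFun_apply, integral_withDensity_eq_integral_toReal_smul (by fun_prop) (by simp)]
  simp_rw [ENNReal.toReal_ofReal (hf0 _), Complex.real_smul]

/-- By Fourier inversion of the Schwartz function `f`, the characteristic function of `f μ` is an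
average of translates of that of `μ`. A shift by `2 π t` costs at most a factor `1 + 2 π ‖t‖`,
integrable against `𝓕 f`. The constant `K` depends on `f` only, which keeps later bounds uniform
along the sequence of measures. -/
lemma norm_charFun_weightedMeasure_le {f : V → ℝ} (hf : HasCompactSupport f)
    (hf' : ContDiff ℝ (⊤ : ℕ∞) f) (hf0 : ∀ x, 0 ≤ f x) :
    ∃ K : ℝ, 0 ≤ K ∧ ∀ (μ : Measure V) [IsFiniteMeasure μ] (A : ℝ),
      (∀ ξ, ‖charFun μ ξ‖ * (1 + ‖ξ‖) ^ (1 / 4 : ℝ) ≤ A) →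
      ∀ ξ, ‖charFun (weightedMeasure f μ) ξ‖ * (1 + ‖ξ‖) ^ (1 / 4 : ℝ) ≤ K * A := by
  have hg : HasCompactSupport fun x => (f x : ℂ) := hf.comp_left (g := ((↑) : ℝ → ℂ)) rfl
  have hg' : ContDiff ℝ (⊤ : ℕ∞) fun x => (f x : ℂ) := Complex.ofRealCLM.contDiff.comp hf'
  let G : SchwartzMap V ℂ := hg.toSchwartzMap hg'
  have hG0 : Integrable (𝓕 G : SchwartzMap V ℂ) := (𝓕 G : SchwartzMap V ℂ).integrable
  have hG1 : Integrable fun t : V => ‖t‖ ^ 1 * ‖(𝓕 G : SchwartzMap V ℂ) t‖ :=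
    (𝓕 G : SchwartzMap V ℂ).integrable_pow_mul volume 1
  have hinv : ∀ x, (f x : ℂ) = ∫ t, cexp (↑(2 * π * inner ℝ t x) * I) • (𝓕 G : SchwartzMap V ℂ) t := by
    intro x
    have h1 : (𝓕⁻ (𝓕 G) : SchwartzMap V ℂ) x = G x := by rw [FourierTransform.fourierInv_fourier_eq]
    rw [SchwartzMap.fourierInv_coe, Real.fourierInv_eq'] at h1
    exact h1.symm
  have hI : Integrable fun t : V => (1 + 2 * π * ‖t‖) * ‖(𝓕 G : SchwartzMap V ℂ) t‖ := by
    have := hG0.norm.add (hG1.const_mul (2 * π))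
    refine this.congr (Filter.Eventually.of_forall fun t => ?_)
    simp only [Pi.add_apply, pow_one]; ring
  refine ⟨∫ t : V, (1 + 2 * π * ‖t‖) * ‖(𝓕 G : SchwartzMap V ℂ) t‖,
    integral_nonneg fun t => by positivity, fun μ _ A hA ξ => ?_⟩
  have hA0 : 0 ≤ A := le_trans (by positivity) (hA 0)
  have hkey : charFun (weightedMeasure f μ) ξ =
      ∫ t, (𝓕 G : SchwartzMap V ℂ) t * charFun μ (ξ + (2 * π) • t) := by
    rw [charFun_weightedMeasure hf'.continuous hf0]
    simp_rw [hinv, ← integral_mul_const]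
    rw [integral_integral_swap]
    · congr 1; ext t
      rw [charFun_apply, ← integral_const_mul]
      congr 1; ext x
      rw [smul_eq_mul, mul_right_comm, ← Complex.exp_add, mul_comm, inner_add_right,
        inner_smul_right, real_inner_comm]
      congr 2
      push_cast; ring
    · have h2 : Integrable (fun p : V × V => (𝓕 G : SchwartzMap V ℂ) p.2) (μ.prod volume) :=
        hG0.comp_snd μ
      refine ((h2.bdd_mul (c := 1) (f := fun p : V × V => cexp (↑(2 * π * inner ℝ p.2 p.1) * I))
        (by fun_prop) (Filter.Eventually.of_forall fun p => ?_)).mul_bdd (c := 1)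
        (g := fun p : V × V => cexp (inner ℝ p.1 ξ * I)) (by fun_prop)
        (Filter.Eventually.of_forall fun p => ?_))
      · rw [Complex.norm_exp_ofReal_mul_I]
      · rw [Complex.norm_exp_ofReal_mul_I]
  have hpos : 0 < (1 + ‖ξ‖) ^ (1 / 4 : ℝ) := by positivity
  rw [hkey, ← le_div_iff₀ hpos]
  have : (∫ t : V, (1 + 2 * π * ‖t‖) * ‖(𝓕 G : SchwartzMap V ℂ) t‖) * A / (1 + ‖ξ‖) ^ (1 / 4 : ℝ)
      = ∫ t : V, (1 + 2 * π * ‖t‖) * ‖(𝓕 G : SchwartzMap V ℂ) t‖ * (A / (1 + ‖ξ‖) ^ (1 / 4 : ℝ)) := by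
    rw [integral_mul_const, mul_div_assoc]
  rw [this]
  refine norm_integral_le_of_norm_le (hI.mul_const _) (Filter.Eventually.of_forall fun t => ?_)
  rw [norm_mul, mul_comm (1 + 2 * π * ‖t‖), mul_assoc]
  gcongr
  have h3 := hA (ξ + (2 * π) • t)
  rw [← mul_div_assoc, le_div_iff₀ hpos]
  have h4 : (1 + ‖ξ‖) ^ (1 / 4 : ℝ) ≤
      (1 + 2 * π * ‖t‖) * (1 + ‖ξ + (2 * π) • t‖) ^ (1 / 4 : ℝ) := by
    have h5 : ‖ξ‖ ≤ ‖ξ + (2 * π) • t‖ + 2 * π * ‖t‖ := by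
      have := norm_sub_le (ξ + (2 * π) • t) ((2 * π) • t)
      rw [add_sub_cancel_right, norm_smul, Real.norm_of_nonneg (by positivity)] at this
      exact this
    have h6 : 0 ≤ 2 * π * ‖t‖ := by positivity
    calc (1 + ‖ξ‖) ^ (1 / 4 : ℝ) ≤ ((1 + 2 * π * ‖t‖) * (1 + ‖ξ + (2 * π) • t‖)) ^ (1 / 4 : ℝ) := by
          refine Real.rpow_le_rpow (by positivity) ?_ (by norm_num)
          nlinarith [mul_nonneg h6 (norm_nonneg (ξ + (2 * π) • t))]
      _ = (1 + 2 * π * ‖t‖) ^ (1 / 4 : ℝ) * (1 + ‖ξ + (2 * π) • t‖) ^ (1 / 4 : ℝ) :=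
          Real.mul_rpow (by positivity) (by positivity)
      _ ≤ _ := by
          gcongr
          exact Real.rpow_le_self_of_one_le (by linarith) (by norm_num)
  calc _ ≤ ‖charFun μ (ξ + (2 * π) • t)‖ *
        ((1 + 2 * π * ‖t‖) * (1 + ‖ξ + (2 * π) • t‖) ^ (1 / 4 : ℝ)) := by gcongr
    _ = (1 + 2 * π * ‖t‖) *
        (‖charFun μ (ξ + (2 * π) • t)‖ * (1 + ‖ξ + (2 * π) • t‖) ^ (1 / 4 : ℝ)) := by ring
    _ ≤ _ := by gcongr

/-- A linear image evaluates the characteristic function at the adjoint frequency, whose norm is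
comparable to `‖ξ‖` because `S` is invertible. -/
lemma norm_charFun_map_le (S : V ≃L[ℝ] V) (m : Measure V) {D : ℝ}
    (h : ∀ ξ, ‖charFun m ξ‖ * (1 + ‖ξ‖) ^ (1 / 4 : ℝ) ≤ D) (ξ : V) :
    ‖charFun (m.map (S : V →L[ℝ] V)) ξ‖ * (1 + ‖ξ‖) ^ (1 / 4 : ℝ) ≤
      (1 + ‖(S.symm : V →L[ℝ] V)‖) * D := by
  set η := ContinuousLinearMap.adjoint (S : V →L[ℝ] V) ξ with hη
  have e : charFun (m.map (S : V →L[ℝ] V)) ξ = charFun m η := by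
    rw [charFun_map_clm, charFun_apply]
    simp_rw [hη, ContinuousLinearMap.adjoint_inner_right]
  have hξ : ‖ξ‖ ≤ ‖(S.symm : V →L[ℝ] V)‖ * ‖η‖ := by
    have e2 : ContinuousLinearMap.adjoint (S.symm : V →L[ℝ] V) η = ξ := by
      refine ext_inner_left ℝ fun v => ?_
      rw [ContinuousLinearMap.adjoint_inner_right, hη, ContinuousLinearMap.adjoint_inner_right]
      simp
    calc ‖ξ‖ = ‖ContinuousLinearMap.adjoint (S.symm : V →L[ℝ] V) η‖ := by rw [e2]
      _ ≤ ‖ContinuousLinearMap.adjoint (S.symm : V →L[ℝ] V)‖ * ‖η‖ :=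
          ContinuousLinearMap.le_opNorm _ _
      _ = _ := by rw [LinearIsometryEquiv.norm_map]
  have hs := norm_nonneg (S.symm : V →L[ℝ] V)
  have h4 : (1 + ‖ξ‖) ^ (1 / 4 : ℝ) ≤
      (1 + ‖(S.symm : V →L[ℝ] V)‖) * (1 + ‖η‖) ^ (1 / 4 : ℝ) := by
    calc (1 + ‖ξ‖) ^ (1 / 4 : ℝ) ≤ ((1 + ‖(S.symm : V →L[ℝ] V)‖) * (1 + ‖η‖)) ^ (1 / 4 : ℝ) := by
          refine Real.rpow_le_rpow (by positivity) ?_ (by norm_num)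
          nlinarith [norm_nonneg η]
      _ = (1 + ‖(S.symm : V →L[ℝ] V)‖) ^ (1 / 4 : ℝ) * (1 + ‖η‖) ^ (1 / 4 : ℝ) :=
          Real.mul_rpow (by positivity) (by positivity)
      _ ≤ _ := by
          gcongr
          exact Real.rpow_le_self_of_one_le (by linarith) (by norm_num)
  rw [e]
  calc _ ≤ ‖charFun m η‖ * ((1 + ‖(S.symm : V →L[ℝ] V)‖) * (1 + ‖η‖) ^ (1 / 4 : ℝ)) := by gcongr
    _ = (1 + ‖(S.symm : V →L[ℝ] V)‖) * (‖charFun m η‖ * (1 + ‖η‖) ^ (1 / 4 : ℝ)) := by ring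
    _ ≤ _ := by gcongr; exact h η

lemma map_closedBall_le (Q : V ≃L[ℝ] V) (m : Measure V) [IsFiniteMeasure m] {A α : ℝ} (hA : 0 ≤ A)
    (hα : α ≤ Module.finrank ℝ V)
    (h : ∀ x r, 0 < r → m.real (Metric.closedBall x r) ≤ A * r ^ α) (x : V) (r : ℝ) (hr : 0 < r) :
    (m.map (Q : V →L[ℝ] V)).real (Metric.closedBall x r) ≤
      A * (1 + ‖(Q.symm : V →L[ℝ] V)‖) ^ Module.finrank ℝ V * r ^ α := by
  have hs := norm_nonneg (Q.symm : V →L[ℝ] V)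
  rw [map_measureReal_apply (by fun_prop) Metric.isClosed_closedBall.measurableSet]
  have hsub : (Q : V →L[ℝ] V) ⁻¹' Metric.closedBall x r ⊆
      Metric.closedBall (Q.symm x) ((1 + ‖(Q.symm : V →L[ℝ] V)‖) * r) := by
    intro y hy
    simp only [Set.mem_preimage, Metric.mem_closedBall, dist_eq_norm] at hy ⊢
    have e : y - Q.symm x = (Q.symm : V →L[ℝ] V) (Q y - x) := by simp
    rw [e]
    refine (ContinuousLinearMap.le_opNorm _ _).trans ?_
    exact mul_le_mul (by linarith) hy (norm_nonneg _) (by positivity)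
  refine (measureReal_mono hsub).trans ((h _ _ (by positivity)).trans ?_)
  rw [Real.mul_rpow (by positivity) hr.le, ← mul_assoc]
  gcongr
  rw [← Real.rpow_natCast]
  exact Real.rpow_le_rpow_of_exponent_le (by linarith) hα
end decay

/-! ### Steinhaus argument and the lower bound for absolutely continuous measures. -/

section steinhaus
open Filter Topology
variable {V : Type*} [NormedAddCommGroup V] [InnerProductSpace ℝ V] [FiniteDimensional ℝ V]
  [MeasurableSpace V] [BorelSpace V]

/-- A uniform Steinhaus theorem for three simultaneous translations. -/
lemma exists_forall_le_volume_inter_translates {K : Set V} (hK : IsCompact K)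
    (hpos : 0 < volume K) :
    ∃ ρ > 0, ∃ κ > 0, ∀ t₁ t₂ t₃ : V, ‖t₁‖ < ρ → ‖t₂‖ < ρ → ‖t₃‖ < ρ →
      κ ≤ volume.real {x | x ∈ K ∧ x + t₁ ∈ K ∧ x + t₂ ∈ K ∧ x + t₃ ∈ K} := by
  have hKfin := hK.measure_lt_top (μ := (volume : Measure V))
  have hKr : 0 < volume.real K := ENNReal.toReal_pos hpos.ne' hKfin.ne
  -- Small translates of `K` stay in `U`, so each of the three translations loses at most a quarter
  -- of the volume of `K`, and a quarter survives.
  obtain ⟨U, hKU, hU, hUm⟩ := hK.exists_isOpen_lt_add (μ := volume)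
    (ε := ENNReal.ofReal (volume.real K / 4)) (by simpa using hKr)
  have hUfin : volume U ≠ ⊤ := (hUm.trans (by simp [hKfin])).ne
  have hdiff : volume.real (U \ K) ≤ volume.real K / 4 := by
    rw [measureReal_sdiff hKU hK.measurableSet hUfin]
    have h1 := ENNReal.toReal_mono (by simp [hKfin.ne]) hUm.le
    rw [ENNReal.toReal_add hKfin.ne (by simp), ENNReal.toReal_ofReal (by positivity)] at h1
    simp only [Measure.real] at h1 ⊢
    linarith
  obtain ⟨ρ, hρ, hsub⟩ := hK.exists_thickening_subset_open hU hKU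
  refine ⟨ρ, hρ, volume.real K / 4, by positivity, fun t₁ t₂ t₃ h₁ h₂ h₃ => ?_⟩
  have hbad : ∀ t : V, ‖t‖ < ρ → volume.real {x | x ∈ K ∧ x + t ∉ K} ≤ volume.real K / 4 := by
    intro t ht
    refine le_trans ?_ hdiff
    have e : {x | x ∈ K ∧ x + t ∉ K} ⊆ (fun x => x + t) ⁻¹' (U \ K) := by
      rintro x ⟨hx, hx'⟩
      refine ⟨hsub ?_, hx'⟩
      rw [Metric.mem_thickening_iff]
      exact ⟨x, hx, by simpa [dist_eq_norm] using ht⟩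
    have e2 : volume.real ((fun x => x + t) ⁻¹' (U \ K)) = volume.real (U \ K) := by
      simp only [Measure.real, measure_preimage_add_right]
    rw [← e2]
    refine measureReal_mono e ?_
    rw [measure_preimage_add_right]
    exact ((measure_mono Set.sdiff_subset).trans_lt hUfin.lt_top).ne
  have hcover : K ⊆ {x | x ∈ K ∧ x + t₁ ∈ K ∧ x + t₂ ∈ K ∧ x + t₃ ∈ K} ∪
      ({x | x ∈ K ∧ x + t₁ ∉ K} ∪ ({x | x ∈ K ∧ x + t₂ ∉ K} ∪ {x | x ∈ K ∧ x + t₃ ∉ K})) := by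
    intro x hx
    simp only [Set.mem_union, Set.mem_ofPred_eq]
    tauto
  have h4 := measureReal_mono hcover (μ := volume) (by
    refine (lt_of_le_of_lt (measure_mono ?_) hKfin).ne
    intro x hx
    simp only [Set.mem_union, Set.mem_ofPred_eq] at hx
    tauto)
  have h5 := measureReal_union_le (μ := volume)
    {x | x ∈ K ∧ x + t₁ ∈ K ∧ x + t₂ ∈ K ∧ x + t₃ ∈ K}
      ({x | x ∈ K ∧ x + t₁ ∉ K} ∪ ({x | x ∈ K ∧ x + t₂ ∉ K} ∪ {x | x ∈ K ∧ x + t₃ ∉ K}))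
  have h6 := measureReal_union_le (μ := volume)
    {x | x ∈ K ∧ x + t₁ ∉ K} ({x | x ∈ K ∧ x + t₂ ∉ K} ∪ {x | x ∈ K ∧ x + t₃ ∉ K})
  have h7 := measureReal_union_le (μ := volume)
    {x | x ∈ K ∧ x + t₂ ∉ K} {x | x ∈ K ∧ x + t₃ ∉ K}
  linarith [hbad t₁ h₁, hbad t₂ h₂, hbad t₃ h₃]

/-- The heat kernel keeps a fixed proportion of its mass in any fixed ball. -/
lemma exists_le_lintegral_heatKernel_ball {ρ : ℝ} (hρ : 0 < ρ) :
    ∃ c : ENNReal, 0 < c ∧ ∀ b : ℝ, 0 < b → b ≤ 1 →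
      c ≤ ∫⁻ h in Metric.ball (0 : V) ρ, ENNReal.ofReal (heatKernel b (-h)) := by
  set d := Module.finrank ℝ V with hd
  refine ⟨ENNReal.ofReal (Real.pi ^ (d / 2 : ℝ) * Real.exp (-ρ ^ 2 / 4)) *
    volume (Metric.ball (0 : V) ρ), ?_, fun b hb hb1 => ?_⟩
  · refine ENNReal.mul_pos ?_ (Metric.measure_ball_pos volume _ hρ).ne'
    simp only [ne_eq, ENNReal.ofReal_eq_zero, not_le]
    have := Real.pi_pos
    positivity
  have hsb : 0 < √b := Real.sqrt_pos.2 hb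
  have hsb1 : √b ≤ 1 := Real.sqrt_le_one.2 hb1
  have hsub : Metric.ball (0 : V) (√b * ρ) ⊆ Metric.ball 0 ρ :=
    Metric.ball_subset_ball (by nlinarith)
  calc _ = ENNReal.ofReal ((Real.pi / b) ^ (d / 2 : ℝ) * Real.exp (-ρ ^ 2 / 4)) *
        volume (Metric.ball (0 : V) (√b * ρ)) := by
        rw [Measure.addHaar_ball_mul_of_pos _ _ hsb, ← mul_assoc, ← ENNReal.ofReal_mul (by
          have := Real.pi_pos; positivity)]
        congr 2
        rw [Real.div_rpow Real.pi_pos.le hb.le, Real.sqrt_eq_rpow, ← Real.rpow_mul_natCast hb.le, ← hd]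
        have : (1 / 2 * d : ℝ) = d / 2 := by ring
        rw [this]
        have := Real.rpow_pos_of_pos hb (d / 2)
        field_simp
    _ = ∫⁻ h in Metric.ball (0 : V) (√b * ρ),
          ENNReal.ofReal ((Real.pi / b) ^ (d / 2 : ℝ) * Real.exp (-ρ ^ 2 / 4)) := by
        rw [setLIntegral_const]
    _ ≤ ∫⁻ h in Metric.ball (0 : V) (√b * ρ), ENNReal.ofReal (heatKernel b (-h)) := by
        refine setLIntegral_mono' Metric.isOpen_ball.measurableSet fun h hh => ?_
        unfold heatKernel
        have := Real.pi_pos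
        refine ENNReal.ofReal_le_ofReal ?_
        rw [← hd]
        refine mul_le_mul_of_nonneg_left (Real.exp_le_exp.2 ?_) (by positivity)
        rw [neg_div, neg_div, neg_le_neg_iff, div_le_div_iff₀ (by positivity) (by norm_num), norm_neg]
        rw [Metric.mem_ball, dist_zero_right] at hh
        have h1 : ‖h‖ ^ 2 ≤ (√b * ρ) ^ 2 := by gcongr
        rw [mul_pow, Real.sq_sqrt hb.le] at h1
        linarith
    _ ≤ _ := lintegral_mono_set hsub

lemma lintegral_relationLaw (S P Q : V →L[ℝ] V) (m₁ m₂ m₃ m₄ : Measure V) [IsFiniteMeasure m₁]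
    [IsFiniteMeasure m₂] [IsFiniteMeasure m₃] [IsFiniteMeasure m₄] {g : V → ENNReal}
    (hg : Measurable g) :
    ∫⁻ v, g v ∂(relationLaw S P Q m₁ m₂ m₃ m₄) =
      ∫⁻ x, ∫⁻ y, ∫⁻ z, ∫⁻ w, g (S x + P y + Q z - w) ∂m₄ ∂m₃ ∂m₂ ∂m₁ := by
  unfold relationLaw
  rw [lintegral_map hg (by fun_prop), lintegral_prod _ (by fun_prop)]
  congr 1; ext x
  rw [lintegral_prod _ (by fun_prop)]
  congr 1; ext y
  rw [lintegral_prod _ (by fun_prop)]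

/-- Substitution in the Lebesgue part of `m`, which lives on the translate `s + K`; the free base
point `a` lets each variable be measured relative to the earlier ones. -/
lemma const_mul_lintegral_indicator_le {K : Set V} (hK : MeasurableSet K) {c : ENNReal}
    {m : Measure V} (s : V) (h : c • volume.restrict ((fun x => -s + x) ⁻¹' K) ≤ m)
    (F : V → ENNReal) (a : V) :
    c * ∫⁻ x, K.indicator 1 (a + x) * F (s + a + x) ≤ ∫⁻ x, F x ∂m := by
  have hK' : MeasurableSet ((fun x => -s + x) ⁻¹' K) := hK.preimage (by fun_prop)
  calc c * ∫⁻ x, K.indicator 1 (a + x) * F (s + a + x)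
      = c * ∫⁻ x, ((fun x => -s + x) ⁻¹' K).indicator F x := by
        rw [← lintegral_add_left_eq_self (((fun x => -s + x) ⁻¹' K).indicator F) (s + a)]
        congr 2; ext x
        have e : -s + (s + a + x) = a + x := by abel
        by_cases hx : a + x ∈ K
        · rw [Set.indicator_of_mem hx, Set.indicator_of_mem (by simpa only [Set.mem_preimage, e]),
            Pi.one_apply, one_mul]
        · rw [Set.indicator_of_notMem hx,
            Set.indicator_of_notMem (by simpa only [Set.mem_preimage, e]), zero_mul]
    _ = ∫⁻ x, F x ∂(c • volume.restrict ((fun x => -s + x) ⁻¹' K)) := by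
        rw [lintegral_smul_measure, smul_eq_mul, ← lintegral_indicator hK']
    _ ≤ _ := lintegral_mono' h le_rfl

/-- Lower bound for the Gaussian averages of a relation law of measures which dominate Lebesgue
measure on translates of a compact set of positive volume. -/
lemma exists_le_integral_heatKernel_relationLaw (S P Q : V →L[ℝ] V)
    (hS : ∀ x, S x + P x + Q x = x) {K : Set V} (hK : IsCompact K) (hpos : 0 < volume K)
    (u v : V) {c : ENNReal} (hc : 0 < c) (hc' : c ≠ ⊤) (m₁ m₂ m₃ m₄ : Measure V) [IsFiniteMeasure m₁]
    [IsFiniteMeasure m₂] [IsFiniteMeasure m₃] [IsFiniteMeasure m₄]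
    (h₁ : c • volume.restrict ((fun x => -0 + x) ⁻¹' K) ≤ m₁)
    (h₂ : c • volume.restrict ((fun x => -u + x) ⁻¹' K) ≤ m₂)
    (h₃ : c • volume.restrict ((fun x => -v + x) ⁻¹' K) ≤ m₃)
    (h₄ : c • volume.restrict ((fun x => -(P u + Q v) + x) ⁻¹' K) ≤ m₄) :
    ∃ κ > 0, ∀ b : ℝ, 0 < b → b ≤ 1 →
      κ ≤ ∫ w, heatKernel b w ∂(relationLaw S P Q m₁ m₂ m₃ m₄) := by
  obtain ⟨ρ, hρ, κ, hκ, hst⟩ := exists_forall_le_volume_inter_translates hK hpos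
  have hKm := hK.measurableSet
  have hind : Measurable (K.indicator (1 : V → ENNReal)) := measurable_one.indicator hKm
  obtain ⟨τ, hτ, hτρ, hτPQ⟩ : ∃ τ > 0, τ ≤ ρ ∧ ∀ x y z : V, ‖x‖ < τ → ‖y‖ < τ → ‖z‖ < τ →
      ‖P x + Q y + z‖ < ρ := by
    refine ⟨ρ / (1 + ‖P‖ + ‖Q‖), by positivity, div_le_self hρ.le (by
      linarith [norm_nonneg P, norm_nonneg Q]), fun x y z hx hy hz => ?_⟩
    have hp : 0 < 1 + ‖P‖ + ‖Q‖ := by positivity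
    calc ‖P x + Q y + z‖ ≤ ‖P x‖ + ‖Q y‖ + ‖z‖ := norm_add₃_le
      _ ≤ ‖P‖ * ‖x‖ + ‖Q‖ * ‖y‖ + ‖z‖ := by gcongr <;> exact ContinuousLinearMap.le_opNorm _ _
      _ < ‖P‖ * (ρ / (1 + ‖P‖ + ‖Q‖)) + ‖Q‖ * (ρ / (1 + ‖P‖ + ‖Q‖)) +
          ρ / (1 + ‖P‖ + ‖Q‖) := by
          refine add_lt_add_of_le_of_lt ?_ hz
          gcongr
      _ = ρ := by field_simp; ring
  obtain ⟨e, he, hheat⟩ := exists_le_lintegral_heatKernel_ball (V := V) hτ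
  set B := Metric.ball (0 : V) τ with hB
  have hBm : MeasurableSet B := Metric.isOpen_ball.measurableSet
  have hBpos : 0 < volume B := Metric.measure_ball_pos volume _ hτ
  set L : ENNReal := c * (c * (c * (c * (ENNReal.ofReal κ * (volume B * (volume B * e)))))) with hL
  have key : ∀ b : ℝ, 0 < b → b ≤ 1 →
      L ≤ ∫⁻ w, ENNReal.ofReal (heatKernel b w) ∂(relationLaw S P Q m₁ m₂ m₃ m₄) := by
    intro b hb hb1
    set g : V → ENNReal := fun w => ENNReal.ofReal (heatKernel b w) with hg
    have hgm : Measurable g := by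
      have := continuous_heatKernel (V := V) b; fun_prop
    rw [lintegral_relationLaw _ _ _ _ _ _ _ hgm]
    have hne : ∀ y, K.indicator (1 : V → ENNReal) y ≠ ⊤ := fun y => by
      by_cases hy : y ∈ K <;> simp [hy]
    -- Substitute `y = u + x + p`, `z = v + x + q` and `w = P u + Q v + x + P p + Q q + h`. As `S +
    -- P + Q = 1`, the relation `S x + P y + Q z - w` collapses to `-h`.
    have step1 : c * ∫⁻ x, K.indicator 1 (0 + x) * (c * ∫⁻ p, K.indicator 1 (x + p) *
        (c * ∫⁻ q, K.indicator 1 (x + q) * (c * ∫⁻ h, K.indicator 1 (x + P p + Q q + h) * g (-h)))) ≤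
        ∫⁻ x, ∫⁻ y, ∫⁻ z, ∫⁻ w, g (S x + P y + Q z - w) ∂m₄ ∂m₃ ∂m₂ ∂m₁ := by
      refine le_trans ?_ (const_mul_lintegral_indicator_le hKm 0 h₁ _ 0)
      gcongr with x
      refine le_trans ?_ (const_mul_lintegral_indicator_le hKm u h₂ _ x)
      gcongr with p
      refine le_trans ?_ (const_mul_lintegral_indicator_le hKm v h₃ _ x)
      gcongr with q
      refine le_trans (le_of_eq ?_)
        (const_mul_lintegral_indicator_le hKm (P u + Q v) h₄ _ (x + P p + Q q))
      congr 2; ext h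
      congr 2
      have := hS x
      simp only [zero_add, map_add]
      have e' : S x + (P u + P x + P p) + (Q v + Q x + Q q) =
        (S x + P x + Q x) + (P u + P p + (Q v + Q q)) := by abel
      rw [e', this]
      abel
    have hcI : ∀ f : V → ENNReal, c * ∫⁻ y, f y = ∫⁻ y, c * f y := fun f =>
      (lintegral_const_mul' _ _ hc').symm
    have hKI : ∀ (a : V) (f : V → ENNReal), K.indicator 1 a * ∫⁻ y, f y =
        ∫⁻ y, K.indicator 1 a * f y := fun a f => (lintegral_const_mul' _ _ (hne a)).symm
    refine le_trans ?_ step1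
    set F : V → V × V × V → ENNReal := fun x p => K.indicator 1 x * (c * (K.indicator 1 (x + p.1) *
      (c * (K.indicator 1 (x + p.2.1) * (c * (K.indicator 1 (x + P p.1 + Q p.2.1 + p.2.2) *
        g (-p.2.2))))))) with hF
    have hFm : Measurable (Function.uncurry F) := by
      simp only [hF, Function.uncurry_def]; fun_prop
    have hFm' : ∀ x, Measurable (F x) := fun x => hFm.comp measurable_prodMk_left
    have step2 : c * ∫⁻ x, K.indicator 1 (0 + x) * (c * ∫⁻ p, K.indicator 1 (x + p) *
        (c * ∫⁻ q, K.indicator 1 (x + q) * (c * ∫⁻ h, K.indicator 1 (x + P p + Q q + h) * g (-h))))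
        = c * ∫⁻ x, ∫⁻ p, F x p := by
      congr 2; ext x
      rw [Measure.volume_eq_prod, lintegral_prod _ (hFm' x).aemeasurable, zero_add]
      simp only [hcI, hKI, Measure.volume_eq_prod]
      congr 1; ext p
      rw [lintegral_prod _ (by fun_prop)]
    -- Integrating in `x` first leaves the volume of a fourfold intersection of translates of `K`,
    -- at least `κ` for small `p`, `q`, `h`.
    rw [step2, lintegral_lintegral_swap hFm.aemeasurable, Measure.volume_eq_prod,
      lintegral_prod _ (by exact (Measurable.lintegral_prod_left' hFm).aemeasurable), hL]
    have inner : ∀ p q h : V, p ∈ B → q ∈ B → h ∈ B →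
        c * (c * (c * (ENNReal.ofReal κ * g (-h)))) ≤ ∫⁻ x, F x (p, q, h) := by
      intro p q h hp hq hh
      rw [mem_ball_zero_iff] at hp hq hh
      set T := {x | x ∈ K ∧ x + p ∈ K ∧ x + q ∈ K ∧ x + (P p + Q q + h) ∈ K} with hT
      have hTm : MeasurableSet T := by
        have h' : ∀ s : V, MeasurableSet ((fun x => x + s) ⁻¹' K) :=
          fun s => hKm.preimage (by fun_prop)
        exact hKm.inter ((h' _).inter ((h' _).inter (h' _)))
      have hTfin : volume T ≠ ⊤ :=
        ((measure_mono fun x hx => hx.1).trans_lt hK.measure_lt_top).ne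
      have hval : ∫⁻ x, F x (p, q, h) = c * (c * (c * (volume T * g (-h)))) := by
        have : ∀ x, F x (p, q, h) = c * (c * (c * g (-h))) * T.indicator 1 x := by
          intro x
          simp only [hF, add_assoc]
          by_cases hx : x ∈ T
          · have h4 : x + (P p + (Q q + h)) ∈ K := by rw [← add_assoc (P p)]; exact hx.2.2.2
            rw [Set.indicator_of_mem hx.1, Set.indicator_of_mem hx.2.1,
              Set.indicator_of_mem hx.2.2.1, Set.indicator_of_mem h4, Set.indicator_of_mem hx]
            simp
          · rw [Set.indicator_of_notMem hx, mul_zero]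
            by_cases h1 : x ∈ K
            · by_cases h2 : x + p ∈ K
              · by_cases h3 : x + q ∈ K
                · have h4 : x + (P p + (Q q + h)) ∉ K := fun h4 =>
                    hx ⟨h1, h2, h3, by rwa [add_assoc (P p)]⟩
                  simp [h4]
                · simp [h3]
              · simp [h2]
            · simp [h1]
        simp_rw [this]
        rw [lintegral_const_mul _ (measurable_one.indicator hTm), lintegral_indicator_one hTm]
        ring
      rw [hval]
      gcongr
      rw [← ofReal_measureReal hTfin]
      exact ENNReal.ofReal_le_ofReal (hst p q _ (hp.trans_le hτρ) (hq.trans_le hτρ)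
        (hτPQ p q h hp hq hh))
    gcongr
    calc c * (c * (c * (ENNReal.ofReal κ * (volume B * (volume B * e)))))
        ≤ ∫⁻ p in B, ∫⁻ q in B, c * (c * (c * (ENNReal.ofReal κ * ∫⁻ h in B, g (-h)))) := by
          rw [setLIntegral_const, setLIntegral_const]
          calc _ = c * (c * (c * (ENNReal.ofReal κ * e))) * volume B * volume B := by ring
            _ ≤ _ := by gcongr; exact hheat b hb hb1
      _ ≤ ∫⁻ p in B, ∫⁻ q in B, ∫⁻ h in B, ∫⁻ x, F x (p, q, h) := by
          refine setLIntegral_mono' hBm fun p hp => setLIntegral_mono' hBm fun q hq => ?_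
          rw [← lintegral_const_mul' _ _ ENNReal.ofReal_ne_top, ← lintegral_const_mul' _ _ hc',
            ← lintegral_const_mul' _ _ hc', ← lintegral_const_mul' _ _ hc']
          exact setLIntegral_mono' hBm fun h hh => inner p q h hp hq hh
      _ ≤ ∫⁻ p, ∫⁻ q, ∫⁻ h, ∫⁻ x, F x (p, q, h) := by
          refine (setLIntegral_le_lintegral _ _).trans (lintegral_mono fun p => ?_)
          refine (setLIntegral_le_lintegral _ _).trans (lintegral_mono fun q => ?_)
          exact setLIntegral_le_lintegral _ _
      _ ≤ _ := by
          refine lintegral_mono fun p => ?_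
          rw [Measure.volume_eq_prod, lintegral_prod]
          exact ((Measurable.lintegral_prod_left' hFm).comp (by fun_prop)).aemeasurable
  have hLpos : 0 < L := by
    rw [hL]
    have := ENNReal.ofReal_pos.2 hκ
    positivity
  have hint : ∀ b : ℝ, 0 < b → Integrable (heatKernel b) (relationLaw S P Q m₁ m₂ m₃ m₄) := by
    intro b hb
    refine Integrable.of_bound (continuous_heatKernel b).aestronglyMeasurable
      ((Real.pi / b) ^ (Module.finrank ℝ V / 2 : ℝ)) (Filter.Eventually.of_forall fun w => ?_)
    rw [Real.norm_of_nonneg (heatKernel_nonneg hb w)]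
    exact heatKernel_le hb w
  have key' : ∀ b : ℝ, 0 < b → b ≤ 1 →
      L ≤ ENNReal.ofReal (∫ w, heatKernel b w ∂(relationLaw S P Q m₁ m₂ m₃ m₄)) := by
    intro b hb hb1
    rw [ofReal_integral_eq_lintegral_ofReal (hint b hb)
      (Filter.Eventually.of_forall fun w => heatKernel_nonneg hb w)]
    exact key b hb hb1
  have hLtop : L ≠ ⊤ := ((key' 1 one_pos le_rfl).trans_lt ENNReal.ofReal_lt_top).ne
  refine ⟨L.toReal, ENNReal.toReal_pos hLpos.ne' hLtop, fun b hb hb1 => ?_⟩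
  exact ENNReal.toReal_le_of_le_ofReal (integral_nonneg fun w => heatKernel_nonneg hb w)
    (key' b hb hb1)
end steinhaus

/-! ### Weak limits. -/

section limits
open Filter Topology
variable {V : Type*} [NormedAddCommGroup V] [InnerProductSpace ℝ V] [FiniteDimensional ℝ V]
  [MeasurableSpace V] [BorelSpace V]

/-- Gaussian averages of a measure vanishing near the origin tend to zero. -/
lemma tendsto_integral_heatKernel_of_ball_null (θ : Measure V) [IsFiniteMeasure θ] {t : ℝ}
    (ht : 0 < t) (hθ : θ (Metric.ball 0 t) = 0) :
    Tendsto (fun l : ℕ => ∫ w, heatKernel ((1 / 4) ^ l) w ∂θ) atTop (𝓝 0) := by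
  set d := Module.finrank ℝ V with hd
  have hlim : Tendsto (fun l : ℕ => Real.pi ^ (d / 2 : ℝ) * ((((4 : ℝ) ^ l) ^ (d / 2 : ℝ)) *
      Real.exp (-(t ^ 2 / 4) * (4 : ℝ) ^ l)) * θ.real Set.univ) atTop (𝓝 0) := by
    have h1 := (tendsto_rpow_mul_exp_neg_mul_atTop_nhds_zero (d / 2 : ℝ) (t ^ 2 / 4)
      (by positivity)).comp (tendsto_pow_atTop_atTop_of_one_lt (show (1 : ℝ) < 4 by norm_num))
    simpa using (h1.const_mul (Real.pi ^ (d / 2 : ℝ))).mul_const (θ.real Set.univ)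
  refine squeeze_zero (fun l => integral_nonneg fun w => heatKernel_nonneg (by positivity) w)
    (fun l => ?_) hlim
  have hae : ∀ᵐ w ∂θ, heatKernel ((1 / 4 : ℝ) ^ l) w ≤
      Real.pi ^ (d / 2 : ℝ) * ((((4 : ℝ) ^ l) ^ (d / 2 : ℝ)) *
      Real.exp (-(t ^ 2 / 4) * (4 : ℝ) ^ l)) := by
    have h0 : ∀ᵐ w ∂θ, w ∉ Metric.ball (0 : V) t := measure_eq_zero_iff_ae_notMem.1 hθ
    filter_upwards [h0] with w hw
    rw [mem_ball_zero_iff, not_lt] at hw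
    unfold heatKernel
    rw [← hd, one_div, inv_pow, div_inv_eq_mul, Real.mul_rpow Real.pi_pos.le (by positivity),
      mul_assoc]
    have := Real.pi_pos
    refine mul_le_mul_of_nonneg_left (mul_le_mul_of_nonneg_left (Real.exp_le_exp.2 ?_)
      (by positivity)) (by positivity)
    have h4 : (0 : ℝ) < 4 ^ l := by positivity
    have e : -‖w‖ ^ 2 / (4 * (4 ^ l)⁻¹) = -(‖w‖ ^ 2 / 4) * 4 ^ l := by field_simp
    rw [e]
    have : t ^ 2 ≤ ‖w‖ ^ 2 := by gcongr
    nlinarith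
  calc _ ≤ ∫ w, Real.pi ^ (d / 2 : ℝ) * ((((4 : ℝ) ^ l) ^ (d / 2 : ℝ)) *
      Real.exp (-(t ^ 2 / 4) * (4 : ℝ) ^ l)) ∂θ :=
        integral_mono_of_nonneg (Eventually.of_forall fun w => heatKernel_nonneg (by positivity) w)
          (integrable_const _) hae
    _ = _ := by rw [integral_const, smul_eq_mul, mul_comm]

/-- Probability measures on a fixed ball have a weakly convergent subsequence. -/
lemma exists_subseq_tendsto_of_closedBall (μ : ℕ → ProbabilityMeasure V) (R : ℝ)
    (hμ : ∀ k, (μ k : Measure V) (Metric.closedBall 0 R)ᶜ = 0) :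
    ∃ (ν : ProbabilityMeasure V) (φ : ℕ → ℕ), StrictMono φ ∧ Tendsto (μ ∘ φ) atTop (𝓝 ν) := by
  have ht : IsTightMeasureSet {((m : ProbabilityMeasure V) : Measure V) | m ∈ Set.range μ} := by
    rw [isTightMeasureSet_iff_exists_isCompact_measure_compl_le]
    refine fun ε _ => ⟨Metric.closedBall 0 R, isCompact_closedBall _ _, ?_⟩
    rintro _ ⟨_, ⟨k, rfl⟩, rfl⟩
    rw [hμ k]; exact zero_le
  obtain ⟨ν, -, φ, hφ, h⟩ := (isCompact_closure_of_isTightMeasureSet ht).tendsto_subseq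
    (fun k => subset_closure (Set.mem_range_self k))
  exact ⟨ν, φ, hφ, h⟩

/-- Ball conditions with exponents tending to `α` pass to weak limits. -/
lemma closedBall_le_of_tendsto {μ : ℕ → ProbabilityMeasure V} {ν : ProbabilityMeasure V}
    (h : Tendsto μ atTop (𝓝 ν)) {A : ℝ} {α : ℕ → ℝ} {a : ℝ} (hα : Tendsto α atTop (𝓝 a))
    (hball : ∀ k x r, 0 < r → (μ k : Measure V).real (Metric.closedBall x r) ≤ A * r ^ α k)
    (x : V) {r : ℝ} (hr : 0 < r) :
    (ν : Measure V).real (Metric.closedBall x r) ≤ A * (2 * r) ^ a := by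
  -- A continuous function between the indicators of the balls of radius `r` and `2 r`; hence the `2
  -- r` in the conclusion.
  let f : ContDiffBump x := ⟨r, 2 * r, hr, by linarith⟩
  have hfc : Continuous f := f.continuous
  let F : BoundedContinuousFunction V ℝ := BoundedContinuousFunction.ofNormedAddCommGroup f hfc 1
    (fun y => by rw [Real.norm_of_nonneg f.nonneg]; exact f.le_one)
  have h1 := (ProbabilityMeasure.tendsto_iff_forall_integral_tendsto.1 h) F
  have h2 : Tendsto (fun k => A * (2 * r) ^ α k) atTop (𝓝 (A * (2 * r) ^ a)) :=
    ((tendsto_const_nhds (x := 2 * r)).rpow hα (Or.inl (by positivity))).const_mul A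
  have hint : ∀ m : ProbabilityMeasure V, Integrable F (m : Measure V) := fun m =>
    F.integrable _
  have h3 : ∀ k, ∫ y, F y ∂(μ k : Measure V) ≤ A * (2 * r) ^ α k := by
    intro k
    refine le_trans ?_ (hball k x (2 * r) (by positivity))
    rw [← integral_indicator_one Metric.isClosed_closedBall.measurableSet]
    refine integral_mono (hint _) ((integrable_const (1 : ℝ)).indicator
      Metric.isClosed_closedBall.measurableSet) fun y => ?_
    by_cases hy : y ∈ Metric.closedBall x (2 * r)
    · rw [Set.indicator_of_mem hy]; exact f.le_one
    · rw [Set.indicator_of_notMem hy]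
      refine (f.zero_of_le_dist ?_).le
      rw [Metric.mem_closedBall, not_le] at hy
      exact hy.le
  refine le_trans ?_ (le_of_tendsto_of_tendsto' h1 h2 h3)
  rw [← integral_indicator_one Metric.isClosed_closedBall.measurableSet]
  refine integral_mono ((integrable_const (1 : ℝ)).indicator
      Metric.isClosed_closedBall.measurableSet) (hint _) fun y => ?_
  by_cases hy : y ∈ Metric.closedBall x r
  · rw [Set.indicator_of_mem hy]; exact (f.one_of_mem_closedBall hy).ge
  · rw [Set.indicator_of_notMem hy]; exact f.nonneg

/-- A measure with the ball condition of exponent equal to the dimension is absolutely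
continuous. -/
lemma absolutelyContinuous_of_closedBall_le (ν : Measure V) [IsFiniteMeasure ν] {A : ℝ}
    (h : ∀ x r, 0 < r → ν.real (Metric.closedBall x r) ≤ A * (2 * r) ^ (Module.finrank ℝ V : ℝ)) :
    ν ≪ (volume : Measure V) := by
  set v₁ := volume (Metric.ball (0 : V) 1) with hv
  have hv0 : v₁ ≠ 0 := (Metric.measure_ball_pos volume _ one_pos).ne'
  have hvt : v₁ ≠ ⊤ := measure_ball_lt_top.ne
  set c : NNReal := (A * 2 ^ Module.finrank ℝ V).toNNReal * v₁.toNNReal⁻¹ with hc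
  have hle : ∀ s, ν s ≤ (c • volume : Measure V) s := by
    intro s
    -- Both measures of a ball scale like `r ^ d`; Besicovitch covering extends the comparison from
    -- balls to all sets.
    refine (Besicovitch.vitaliFamily ν).measure_le_of_frequently_le _ Measure.AbsolutelyContinuous.rfl
      s fun x _ => ?_
    refine (Besicovitch.tendsto_filterAt ν x).frequently (Eventually.frequently ?_)
    filter_upwards [self_mem_nhdsWithin] with r hr
    have hr : 0 < r := hr
    rw [← ofReal_measureReal (measure_ne_top ν _), Measure.smul_apply,
      Measure.addHaar_closedBall _ _ hr.le]
    refine (ENNReal.ofReal_le_ofReal (h x r hr)).trans (le_of_eq ?_)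
    rw [Real.rpow_natCast, mul_pow, ← mul_assoc, ENNReal.ofReal_mul' (by positivity), ← hv, hc,
      ENNReal.smul_def, smul_eq_mul, ENNReal.coe_mul, ENNReal.coe_inv (by
        simpa [ENNReal.toNNReal_eq_zero_iff] using ⟨hv0, hvt⟩), ENNReal.coe_toNNReal hvt,
      mul_comm (ENNReal.ofReal _) v₁, mul_assoc, ← mul_assoc v₁⁻¹, ENNReal.inv_mul_cancel hv0 hvt,
      one_mul]
    rfl
  refine Measure.AbsolutelyContinuous.mk fun s _ hs => ?_
  refine le_antisymm ((hle s).trans ?_) zero_le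
  simp [hs]

/-- A nonzero absolutely continuous measure dominates a multiple of Lebesgue measure on a compact
set of positive volume. -/
lemma exists_isCompact_smul_restrict_le (ν : Measure V) [IsFiniteMeasure ν] (hν : ν ≠ 0)
    (hac : ν ≪ volume) :
    ∃ (K : Set V) (c : ENNReal), IsCompact K ∧ 0 < volume K ∧ 0 < c ∧ c ≠ ⊤ ∧
      c • volume.restrict K ≤ ν := by
  set f := ν.rnDeriv volume with hf
  have hfm : Measurable f := Measure.measurable_rnDeriv _ _
  have hνf : volume.withDensity f = ν := Measure.withDensity_rnDeriv_eq _ _ hac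
  obtain ⟨n, hn⟩ : ∃ n : ℕ, 0 < volume {x | ((n : ENNReal) + 1)⁻¹ ≤ f x} := by
    by_contra! hcon
    have h0 : volume (⋃ n : ℕ, {x | ((n : ENNReal) + 1)⁻¹ ≤ f x}) = 0 :=
      measure_iUnion_null fun n => le_antisymm (hcon n) zero_le
    apply hν
    rw [← hνf, withDensity_eq_zero_iff hfm.aemeasurable]
    filter_upwards [measure_eq_zero_iff_ae_notMem.1 h0] with x hx
    by_contra hfx
    apply hx
    obtain ⟨n, hn⟩ := ENNReal.exists_inv_nat_lt hfx
    refine Set.mem_iUnion.2 ⟨n, le_trans ?_ hn.le⟩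
    exact ENNReal.inv_le_inv.2 le_self_add
  obtain ⟨K, hKsub, hK, hKpos⟩ := (measurableSet_le measurable_const hfm).exists_lt_isCompact hn
  refine ⟨K, ((n : ENNReal) + 1)⁻¹, hK, hKpos, by simp, by simp, ?_⟩
  rw [← withDensity_const, ← hνf, ← withDensity_indicator hK.measurableSet]
  refine withDensity_mono (Eventually.of_forall fun x => ?_)
  by_cases hx : x ∈ K
  · rw [Set.indicator_of_mem hx]; exact hKsub hx
  · rw [Set.indicator_of_notMem hx]; exact zero_le

/-- Gaussian averages of relation laws of weighted measures are weakly continuous. -/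
lemma tendsto_integral_heatKernel_relationLaw (S P Q : V →L[ℝ] V) {μ : ℕ → ProbabilityMeasure V}
    {ν : ProbabilityMeasure V} (h : Tendsto μ atTop (𝓝 ν)) {f : Fin 4 → V → ℝ}
    (hf : ∀ j, Continuous (f j)) (hf0 : ∀ j x, 0 ≤ f j x) (hf1 : ∀ j x, f j x ≤ 1) {b : ℝ}
    (hb : 0 < b) :
    Tendsto (fun k => ∫ w, heatKernel b w ∂(relationLaw S P Q (weightedMeasure (f 0) (μ k))
      (weightedMeasure (f 1) (μ k)) (weightedMeasure (f 2) (μ k)) (weightedMeasure (f 3) (μ k))))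
      atTop (𝓝 (∫ w, heatKernel b w ∂(relationLaw S P Q (weightedMeasure (f 0) ν)
      (weightedMeasure (f 1) ν) (weightedMeasure (f 2) ν) (weightedMeasure (f 3) ν)))) := by
  have hfin : ∀ j (m : ProbabilityMeasure V), IsFiniteMeasure (weightedMeasure (f j) (m : Measure V)) :=
    fun j m => isFiniteMeasure_weightedMeasure (hf1 j) _
  have hmass : ∀ j (m : ProbabilityMeasure V), (weightedMeasure (f j) (m : Measure V)).real Set.univ ≤ 1 :=
    fun j m => (weightedMeasure_real_le (hf1 j) _ _).trans_eq (by simp)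
  have hchar : ∀ j (T : V →L[ℝ] V) ξ, Tendsto
      (fun k => charFun ((weightedMeasure (f j) (μ k : Measure V)).map T) ξ) atTop
      (𝓝 (charFun ((weightedMeasure (f j) (ν : Measure V)).map T) ξ)) := by
    intro j T ξ
    have e : ∀ m : ProbabilityMeasure V, charFun ((weightedMeasure (f j) (m : Measure V)).map T) ξ =
        ∫ x, (f j x : ℂ) * Complex.exp (inner ℝ (T x) ξ * Complex.I) ∂(m : Measure V) := by
      intro m
      rw [charFun_map_clm]
      unfold weightedMeasure
      rw [integral_withDensity_eq_integral_toReal_smul (by have := hf j; fun_prop) (by simp)]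
      simp_rw [ENNReal.toReal_ofReal (hf0 j _), Complex.real_smul]
    simp_rw [e]
    let F : BoundedContinuousFunction V ℂ := BoundedContinuousFunction.ofNormedAddCommGroup
      (fun x => (f j x : ℂ) * Complex.exp (inner ℝ (T x) ξ * Complex.I))
      (by have := hf j; fun_prop) 1 (fun x => by
        rw [norm_mul, Complex.norm_exp_ofReal_mul_I, mul_one, Complex.norm_real,
          Real.norm_of_nonneg (hf0 j x)]
        exact hf1 j x)
    exact (ProbabilityMeasure.tendsto_iff_forall_integral_rclike_tendsto ℂ).1 h F
  have hchar' : ∀ j ξ, Tendsto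
      (fun k => charFun (weightedMeasure (f j) (μ k : Measure V)) ξ) atTop
      (𝓝 (charFun (weightedMeasure (f j) (ν : Measure V)) ξ)) := by
    intro j ξ
    have := hchar j (ContinuousLinearMap.id ℝ V) ξ
    simpa using this
  -- On the Fourier side the law factors into integrals of bounded continuous functions against
  -- single measures, so weak convergence of products is not needed; the Gaussian dominates.
  have key : Tendsto (fun k => ∫ ξ : V, (Real.exp (-b * ‖ξ‖ ^ 2) : ℂ) * charFun (relationLaw S P Q (weightedMeasure (f 0) (μ k))
      (weightedMeasure (f 1) (μ k)) (weightedMeasure (f 2) (μ k)) (weightedMeasure (f 3) (μ k))) ξ)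
      atTop (𝓝 (∫ ξ : V, (Real.exp (-b * ‖ξ‖ ^ 2) : ℂ) * charFun (relationLaw S P Q (weightedMeasure (f 0) ν)
      (weightedMeasure (f 1) ν) (weightedMeasure (f 2) ν) (weightedMeasure (f 3) ν)) ξ)) := by
    refine tendsto_integral_of_dominated_convergence (fun ξ => Real.exp (-b * ‖ξ‖ ^ 2)) ?_
      (integrable_gaussian hb) ?_ ?_
    · intro k
      refine AEStronglyMeasurable.mul (by fun_prop) ?_
      exact stronglyMeasurable_charFun.aestronglyMeasurable
    · refine fun k => Eventually.of_forall fun ξ => ?_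
      rw [norm_mul, Complex.norm_real, Real.norm_of_nonneg (Real.exp_pos _).le]
      refine mul_le_of_le_one_right (Real.exp_pos _).le ?_
      rw [charFun_relationLaw]
      simp only [norm_mul]
      have hb1 : ∀ j (T : V →L[ℝ] V), ‖charFun ((weightedMeasure (f j) (μ k : Measure V)).map T) ξ‖ ≤ 1 := by
        intro j T
        refine (norm_charFun_le ξ).trans ?_
        rw [map_measureReal_apply (by fun_prop) MeasurableSet.univ, Set.preimage_univ]
        exact hmass j _
      have hb2 := (norm_charFun_le (μ := weightedMeasure (f 3) (μ k : Measure V)) (-ξ)).trans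
        (hmass 3 (μ k))
      refine mul_le_one₀ (hb1 _ _) (by positivity) (mul_le_one₀ (hb1 _ _) (by positivity)
        (mul_le_one₀ (hb1 _ _) (by positivity) hb2))
    · refine Eventually.of_forall fun ξ => ?_
      simp_rw [charFun_relationLaw]
      exact ((hchar 0 S ξ).mul ((hchar 1 P ξ).mul ((hchar 2 Q ξ).mul (hchar' 3 (-ξ))))).const_mul _
  simp_rw [integral_gaussian_mul_charFun hb] at key
  exact (Complex.continuous_re.tendsto _).comp key
end limits

/-! ### Solutions of the linear equation in the support. -/

section configurations
open Filter Topology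
variable {V : Type*} [NormedAddCommGroup V] [InnerProductSpace ℝ V] [FiniteDimensional ℝ V]
  [MeasurableSpace V] [BorelSpace V]

/-- If a linear relation has no solution in a product of compact sets, then the relation law of
measures on these sets vanishes near the origin. -/
lemma exists_relationLaw_ball_eq_zero (S P Q : V →L[ℝ] V) (m₁ m₂ m₃ m₄ : Measure V)
    [IsFiniteMeasure m₁] [IsFiniteMeasure m₂] [IsFiniteMeasure m₃] [IsFiniteMeasure m₄]
    {N₁ N₂ N₃ N₄ : Set V} (hN₁ : IsCompact N₁) (hN₂ : IsCompact N₂) (hN₃ : IsCompact N₃)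
    (hN₄ : IsCompact N₄) (h₁ : ∀ᵐ x ∂m₁, x ∈ N₁) (h₂ : ∀ᵐ x ∂m₂, x ∈ N₂)
    (h₃ : ∀ᵐ x ∂m₃, x ∈ N₃) (h₄ : ∀ᵐ x ∂m₄, x ∈ N₄)
    (hno : ∀ x ∈ N₁, ∀ y ∈ N₂, ∀ z ∈ N₃, ∀ w ∈ N₄, S x + P y + Q z ≠ w) :
    ∃ t > 0, relationLaw S P Q m₁ m₂ m₃ m₄ (Metric.ball 0 t) = 0 := by
  set T : V × V × V × V → V := fun z => S z.1 + P z.2.1 + Q z.2.2.1 - z.2.2.2 with hT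
  have hTc : Continuous T := by fun_prop
  have hcomp := (hN₁.prod (hN₂.prod (hN₃.prod hN₄))).image hTc
  have h0 : (0 : V) ∈ (T '' (N₁ ×ˢ (N₂ ×ˢ (N₃ ×ˢ N₄))))ᶜ := by
    rintro ⟨⟨x, y, z, w⟩, ⟨hx, hy, hz, hw⟩, he⟩
    exact hno x hx y hy z hz w hw (sub_eq_zero.1 he)
  obtain ⟨t, ht, hsub⟩ := Metric.isOpen_iff.1 hcomp.isClosed.isOpen_compl 0 h0
  refine ⟨t, ht, ?_⟩
  unfold relationLaw
  rw [Measure.map_apply hTc.measurable Metric.isOpen_ball.measurableSet,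
    measure_eq_zero_iff_ae_notMem]
  have a₁ := Measure.quasiMeasurePreserving_fst (μ := m₁) (ν := m₂.prod (m₃.prod m₄)) |>.ae h₁
  have a₂ := Measure.quasiMeasurePreserving_snd (μ := m₁) (ν := m₂.prod (m₃.prod m₄)) |>.ae
    (Measure.quasiMeasurePreserving_fst (μ := m₂) (ν := m₃.prod m₄) |>.ae h₂)
  have a₃ := Measure.quasiMeasurePreserving_snd (μ := m₁) (ν := m₂.prod (m₃.prod m₄)) |>.ae
    (Measure.quasiMeasurePreserving_snd (μ := m₂) (ν := m₃.prod m₄) |>.ae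
      (Measure.quasiMeasurePreserving_fst (μ := m₃) (ν := m₄) |>.ae h₃))
  have a₄ := Measure.quasiMeasurePreserving_snd (μ := m₁) (ν := m₂.prod (m₃.prod m₄)) |>.ae
    (Measure.quasiMeasurePreserving_snd (μ := m₂) (ν := m₃.prod m₄) |>.ae
      (Measure.quasiMeasurePreserving_snd (μ := m₃) (ν := m₄) |>.ae h₄))
  filter_upwards [a₁, a₂, a₃, a₄] with p h1 h2 h3 h4 hp
  exact hsub hp ⟨p, ⟨h1, h2, h3, h4⟩, rfl⟩

/-- A compact set of positive volume contains a translated copy of a small piece of itself along a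
nondegenerate configuration. -/
lemma exists_separated_translates [Nontrivial V] (P Q : V ≃L[ℝ] V) {K : Set V} (hK : IsCompact K)
    (hpos : 0 < volume K) :
    ∃ (u v x₀ : V) (ρ : ℝ) (L : Set V), 0 < ρ ∧ 4 * ρ < ‖u‖ ∧ 4 * ρ < ‖v‖ ∧ 4 * ρ < ‖P u + Q v‖ ∧
      IsCompact L ∧ 0 < volume L ∧ L ⊆ Metric.closedBall x₀ ρ ∧
      ∀ x ∈ L, x ∈ K ∧ x + u ∈ K ∧ x + v ∈ K ∧ x + (P u + Q v) ∈ K := by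
  obtain ⟨ρ₀, hρ₀, κ, hκ, hst⟩ := exists_forall_le_volume_inter_translates hK hpos
  obtain ⟨e, he⟩ := exists_ne (0 : V)
  -- With `Q e₂ = P e`, the third displacement is a positive multiple of `P e`, hence nonzero.
  set e₂ := Q.symm (P e) with he₂
  have hPe : P e ≠ 0 := by simpa using he
  have he₂0 : e₂ ≠ 0 := by simpa [he₂] using he
  obtain ⟨s, hs, h1, h2, h3⟩ : ∃ s : ℝ, 0 < s ∧ ‖s • e‖ < ρ₀ ∧ ‖s • e₂‖ < ρ₀ ∧
      ‖P (s • e) + Q (s • e₂)‖ < ρ₀ := by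
    have c1 : Tendsto (fun s : ℝ => ‖s • e‖) (𝓝[>] 0) (𝓝 0) :=
      (Continuous.tendsto' (by fun_prop) _ _ (by simp)).mono_left nhdsWithin_le_nhds
    have c2 : Tendsto (fun s : ℝ => ‖s • e₂‖) (𝓝[>] 0) (𝓝 0) :=
      (Continuous.tendsto' (by fun_prop) _ _ (by simp)).mono_left nhdsWithin_le_nhds
    have c3 : Tendsto (fun s : ℝ => ‖P (s • e) + Q (s • e₂)‖) (𝓝[>] 0) (𝓝 0) :=
      (Continuous.tendsto' (by fun_prop) _ _ (by simp)).mono_left nhdsWithin_le_nhds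
    obtain ⟨s, ⟨⟨hs1, hs2⟩, hs3⟩, hs4⟩ := (((c1.eventually_lt_const hρ₀).and
      (c2.eventually_lt_const hρ₀)).and (c3.eventually_lt_const hρ₀)).and
      self_mem_nhdsWithin |>.exists
    exact ⟨s, hs4, hs1, hs2, hs3⟩
  set u := s • e with hu
  set v := s • e₂ with hv
  have hu0 : u ≠ 0 := smul_ne_zero hs.ne' he
  have hv0 : v ≠ 0 := smul_ne_zero hs.ne' he₂0
  have hw0 : P u + Q v ≠ 0 := by
    have : P u + Q v = (2 * s) • P e := by
      simp only [hu, hv, he₂, map_smul, ContinuousLinearEquiv.apply_symm_apply]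
      module
    rw [this]
    exact smul_ne_zero (by positivity) hPe
  set G := {x | x ∈ K ∧ x + u ∈ K ∧ x + v ∈ K ∧ x + (P u + Q v) ∈ K} with hG
  have hGc : IsCompact G := by
    have h' : ∀ t : V, IsClosed ((fun x => x + t) ⁻¹' K) :=
      fun t => hK.isClosed.preimage (by fun_prop)
    exact hK.inter_right ((h' _).inter ((h' _).inter (h' _)))
  have hGpos : volume G ≠ 0 := by
    intro h0
    have := hst u v (P u + Q v) h1 h2 h3
    rw [Measure.real, ← hG, h0] at this
    simp at this
    linarith
  -- At such a point the part of `G` in any small ball still has positive volume.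
  obtain ⟨x₀, hx₀, hx⟩ := exists_mem_forall_mem_nhdsWithin_pos_measure hGpos
  have hmin : 0 < min ‖u‖ (min ‖v‖ ‖P u + Q v‖) := by
    simp only [lt_min_iff, norm_pos_iff]
    exact ⟨hu0, hv0, hw0⟩
  set ρ := min ‖u‖ (min ‖v‖ ‖P u + Q v‖) / 5 with hρ
  have hρpos : 0 < ρ := by positivity
  have hlt : 4 * ρ < min ‖u‖ (min ‖v‖ ‖P u + Q v‖) := by rw [hρ]; linarith
  simp only [lt_min_iff] at hlt
  refine ⟨u, v, x₀, ρ, G ∩ Metric.closedBall x₀ ρ, hρpos, hlt.1, hlt.2.1, hlt.2.2,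
    hGc.inter_right Metric.isClosed_closedBall, ?_, Set.inter_subset_right, fun x hx => hx.1⟩
  exact hx _ (inter_mem self_mem_nhdsWithin
    (mem_nhdsWithin_of_mem_nhds (Metric.closedBall_mem_nhds _ hρpos)))

/-- Weighting by a bump function preserves Lebesgue lower bounds on the inner ball. -/
lemma smul_restrict_le_weightedMeasure {ν : Measure V} {K L : Set V} {c : ENNReal}
    (h : c • volume.restrict K ≤ ν) (hL : MeasurableSet L) (hLK : L ⊆ K) {f : V → ℝ}
    (hL1 : ∀ x ∈ L, 1 ≤ f x) :
    c • volume.restrict L ≤ weightedMeasure f ν := by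
  have h1 : ν.restrict L ≤ weightedMeasure f ν := by
    unfold weightedMeasure
    rw [← withDensity_indicator_one hL]
    refine withDensity_mono (Eventually.of_forall fun x => ?_)
    by_cases hx : x ∈ L
    · rw [Set.indicator_of_mem hx]
      simpa using hL1 x hx
    · rw [Set.indicator_of_notMem hx]; exact zero_le
  refine le_trans ?_ h1
  have h2 := Measure.restrict_mono (le_refl L) h
  rwa [Measure.restrict_smul, Measure.restrict_restrict hL, Set.inter_eq_left.2 hLK] at h2

/-- **Configurations in supports of measures with Fourier decay.** A probability measure on a
bounded set with Fourier decay and almost full dimension has in its support nontrivial solutions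
of any equation `w = S x + P y + Q z` with `S + P + Q = 1` and `S`, `P`, `Q` invertible. -/
theorem exists_solution_in_support [Nontrivial V] (S P Q : V ≃L[ℝ] V)
    (hS : ∀ x, S x + P x + Q x = x) (A R : ℝ) (hA : 0 ≤ A) :
    ∃ ε > 0, ∀ α : ℝ, Module.finrank ℝ V - ε < α → α ≤ Module.finrank ℝ V →
      ∀ μ : ProbabilityMeasure V, (μ : Measure V) (Metric.closedBall 0 R)ᶜ = 0 →
      (∀ x r, 0 < r → (μ : Measure V).real (Metric.closedBall x r) ≤ A * r ^ α) →
      (∀ ξ, ‖charFun (μ : Measure V) ξ‖ * (1 + ‖ξ‖) ^ (1 / 4 : ℝ) ≤ A) →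
      ∃ x ∈ (μ : Measure V).support, ∃ y ∈ (μ : Measure V).support,
        ∃ z ∈ (μ : Measure V).support, ∃ w ∈ (μ : Measure V).support,
        w = S x + P y + Q z ∧ y ≠ x ∧ z ≠ x ∧ w ≠ x := by
  set d := Module.finrank ℝ V with hd
  by_contra! hcon
  -- The extra division by `4` gives `α k ≥ d - 1 / 4` for every `k`, as the dyadic estimate
  -- requires.
  choose α hα hα' μ hμR hball hdecay hno using
    fun k : ℕ => hcon (1 / (k + 1 : ℝ) / 4) (by positivity)
  obtain ⟨ν, φ, hφ, hlim⟩ := exists_subseq_tendsto_of_closedBall μ R hμR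
  have hαlim : Tendsto (fun k => α (φ k)) atTop (𝓝 (d : ℝ)) := by
    have h0 : Tendsto (fun k : ℕ => (d : ℝ) - 1 / (k + 1 : ℝ) / 4) atTop (𝓝 d) := by
      simpa using (tendsto_one_div_add_atTop_nhds_zero_nat (𝕜 := ℝ)).div_const 4 |>.const_sub (d : ℝ)
    exact (tendsto_of_tendsto_of_tendsto_of_le_of_le h0 tendsto_const_nhds
      (fun k => (hα k).le) hα').comp hφ.tendsto_atTop
  have hac : (ν : Measure V) ≪ volume := absolutelyContinuous_of_closedBall_le _ (A := A)
    fun x r hr => closedBall_le_of_tendsto hlim hαlim (fun k => hball (φ k)) x hr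
  obtain ⟨K, c, hK, hKpos, hc, hc', hcK⟩ := exists_isCompact_smul_restrict_le (ν : Measure V)
    (IsProbabilityMeasure.ne_zero _) hac
  obtain ⟨u, v, x₀, ρ, L, hρ, hu, hv, hw, hL, hLpos, hLx, hLK⟩ :=
    exists_separated_translates P Q hK hKpos
  let t : Fin 4 → V := ![0, u, v, P u + Q v]
  let f : ∀ j, ContDiffBump (x₀ + t j) := fun j => ⟨ρ, 2 * ρ, hρ, by linarith⟩
  have hf0 : ∀ j x, 0 ≤ f j x := fun j x => (f j).nonneg
  have hf1 : ∀ j x, f j x ≤ 1 := fun j x => (f j).le_one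
  have hfc : ∀ j, Continuous (f j) := fun j => (f j).continuous
  have hfin : ∀ j (m : ProbabilityMeasure V), IsFiniteMeasure (weightedMeasure (f j) (m : Measure V)) :=
    fun j m => isFiniteMeasure_weightedMeasure (hf1 j) _
  let Λ : ProbabilityMeasure V → ℕ → ℝ := fun m l => ∫ w, heatKernel ((1 / 4) ^ l) w ∂(relationLaw
    (S : V →L[ℝ] V) P Q (weightedMeasure (f 0) m) (weightedMeasure (f 1) m)
    (weightedMeasure (f 2) m) (weightedMeasure (f 3) m))
  -- positivity of the limit
  obtain ⟨κ, hκ, hlow⟩ : ∃ κ > 0, ∀ l, κ ≤ Λ ν l := by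
    have hdom : ∀ j, c • volume.restrict ((fun x => -t j + x) ⁻¹' L) ≤
        weightedMeasure (f j) (ν : Measure V) := by
      intro j
      refine smul_restrict_le_weightedMeasure hcK
        (hL.measurableSet.preimage (by fun_prop)) (fun x hx => ?_)
        (fun x hx => ?_)
      · have hx' := hLK _ hx
        fin_cases j
        · simpa [t] using hx'.1
        · simpa [t] using hx'.2.1
        · simpa [t] using hx'.2.2.1
        · have := hx'.2.2.2
          simp only [t] at this
          simpa [add_comm, add_assoc, add_left_comm] using this
      · refine ((f j).one_of_mem_closedBall ?_).ge
        have := hLx hx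
        rw [Metric.mem_closedBall, dist_eq_norm] at this ⊢
        change ‖-t j + x - x₀‖ ≤ ρ at this
        rwa [show -t j + x - x₀ = x - (x₀ + t j) by abel] at this
    obtain ⟨κ, hκ, h⟩ := exists_le_integral_heatKernel_relationLaw (S : V →L[ℝ] V) P Q hS hL hLpos u v hc hc'
      _ _ _ _ (hdom 0) (hdom 1) (hdom 2) (hdom 3)
    exact ⟨κ, hκ, fun l => h _ (by positivity) (pow_le_one₀ (by norm_num) (by norm_num))⟩
  -- uniform smallness
  set r : ℝ := (1 / 4 : ℝ) ^ (1 / 8 : ℝ) with hr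
  have hr0 : 0 ≤ r := by positivity
  have hr1 : r < 1 := Real.rpow_lt_one (by norm_num) (by norm_num) (by norm_num)
  -- `M` must not depend on `k`: it is built from the bump functions, the maps and `A` only. The
  -- bound sums the dyadic differences from scale `l` onwards to the limit `0`.
  obtain ⟨M, hM⟩ : ∃ M : ℝ, ∀ k l, Λ (μ k) l ≤ M * r ^ l / (1 - r) := by
    choose B hB0 hB using fun j => norm_charFun_weightedMeasure_le (f j).hasCompactSupport
      (f j).contDiff (hf0 j)
    set D := (1 + ‖(S.symm : V →L[ℝ] V)‖) * (B 0 * A) + (1 + ‖(P.symm : V →L[ℝ] V)‖) * (B 1 * A)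
      with hD
    set A' := A * (1 + ‖(Q.symm : V →L[ℝ] V)‖) ^ d with hA'
    have hA'A : A ≤ A' := le_mul_of_one_le_right hA
      (one_le_pow₀ (by linarith [norm_nonneg (Q.symm : V →L[ℝ] V)]))
    refine ⟨2 * D ^ 2 * (Real.pi ^ (d / 2 : ℝ) * A' * gaussShellSum d) * 4 ^ (1 / 8 : ℝ),
      fun k l => ?_⟩
    have hstep := abs_integral_heatKernel_relationLaw_sub_le (S : V →L[ℝ] V) P Q
      (weightedMeasure (f 0) (μ k : Measure V)) (weightedMeasure (f 1) (μ k : Measure V))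
      (weightedMeasure (f 2) (μ k : Measure V)) (weightedMeasure (f 3) (μ k : Measure V))
      (D := D) (A := A') (α := α k) (hA.trans hA'A) (hα' k) (by
        have h1 := hα k
        have h2 : 1 / ((k : ℝ) + 1) ≤ 1 := by
          rw [div_le_one (by positivity)]; linarith [Nat.cast_nonneg (α := ℝ) k]
        linarith)
      (fun ξ => (norm_charFun_map_le S _ (hB 0 _ A (hdecay k)) ξ).trans (by
        rw [hD]; have := hB0 1; exact le_add_of_nonneg_right (by positivity)))
      (fun ξ => (norm_charFun_map_le P _ (hB 1 _ A (hdecay k)) ξ).trans (by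
        rw [hD]; have := hB0 0; exact le_add_of_nonneg_left (by positivity)))
      (map_closedBall_le Q _ hA (hα' k) fun x r hr =>
        (weightedMeasure_real_le (hf1 2) _ _).trans (hball k x r hr))
      (fun x r hr => (weightedMeasure_real_le (hf1 3) _ _).trans ((hball k x r hr).trans (by gcongr)))
      ((weightedMeasure_real_le (hf1 2) _ _).trans (by simp))
      ((weightedMeasure_real_le (hf1 3) _ _).trans (by simp))
    have htend : Tendsto (Λ (μ k)) atTop (𝓝 0) := by
      let N : Fin 4 → Set V := fun j => (μ k : Measure V).support ∩
        Metric.closedBall (x₀ + t j) (2 * ρ)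
      have hN : ∀ j, IsCompact (N j) := fun j =>
        (isCompact_closedBall _ _).inter_left Measure.isClosed_support
      have hNae : ∀ j, ∀ᵐ x ∂(weightedMeasure (f j) (μ k : Measure V)), x ∈ N j := by
        intro j
        have a1 : ∀ᵐ x ∂(weightedMeasure (f j) (μ k : Measure V)), x ∈ (μ k : Measure V).support :=
          (Measure.absolutelyContinuous_of_le (weightedMeasure_le (hf1 j) _)).ae_le
            Measure.support_mem_ae
        have a2 : ∀ᵐ x ∂(weightedMeasure (f j) (μ k : Measure V)),
            x ∈ Metric.closedBall (x₀ + t j) (2 * ρ) := by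
          unfold weightedMeasure
          rw [ae_withDensity_iff (by have := hfc j; fun_prop)]
          refine Eventually.of_forall fun x hx => ?_
          by_contra hx'
          apply hx
          rw [Metric.mem_closedBall, not_le] at hx'
          rw [(f j).zero_of_le_dist hx'.le, ENNReal.ofReal_zero]
        filter_upwards [a1, a2] with x h1 h2 using ⟨h1, h2⟩
      -- The bumps have radius `2 ρ` and their centres are more than `4 ρ` from that of the first,
      -- so a solution in the localized supports would be nontrivial, which `hno` forbids.
      have hsep : ∀ (j : Fin 4), 4 * ρ < ‖t j‖ → ∀ x ∈ N 0, ∀ y ∈ N j, y ≠ x := by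
        rintro j hj x hx y hy rfl
        have h1 := hx.2
        have h2 := hy.2
        rw [Metric.mem_closedBall, dist_eq_norm] at h1 h2
        have : t j = (y - (x₀ + t 0)) - (y - (x₀ + t j)) := by simp [t]
        have h3 := norm_sub_le (y - (x₀ + t 0)) (y - (x₀ + t j))
        rw [← this] at h3
        linarith
      obtain ⟨s, hs, hs0⟩ := exists_relationLaw_ball_eq_zero (S : V →L[ℝ] V) P Q
        _ _ _ _ (hN 0) (hN 1) (hN 2) (hN 3) (hNae 0) (hNae 1) (hNae 2) (hNae 3)
        (fun x hx y hy z hz w hwN he => hsep 3 hw x hx w hwN <|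
          hno k x hx.1 y hy.1 z hz.1 w hwN.1 he.symm (hsep 1 hu x hx y hy) (hsep 2 hv x hx z hz))
      exact tendsto_integral_heatKernel_of_ball_null _ hs hs0
    have hgeo := dist_le_of_le_geometric_of_tendsto r _ hr1 (f := Λ (μ k)) (fun l => by
      rw [dist_comm, Real.dist_eq]; exact hstep l) htend l
    rw [Real.dist_eq, sub_zero] at hgeo
    exact (le_abs_self _).trans hgeo
  have hup : ∀ l, Λ ν l ≤ M * r ^ l / (1 - r) := fun l =>
    le_of_tendsto' (tendsto_integral_heatKernel_relationLaw (S : V →L[ℝ] V) P Q hlim (f := fun j => f j) hfc hf0 hf1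
      (b := (1 / 4) ^ l) (by positivity)) fun k => hM (φ k) l
  have hzero : Tendsto (fun l : ℕ => M * r ^ l / (1 - r)) atTop (𝓝 0) := by
    simpa using ((tendsto_pow_atTop_nhds_zero_of_lt_one hr0 hr1).const_mul M).div_const (1 - r)
  exact absurd (ge_of_tendsto' hzero fun l => (hlow l).trans (hup l)) (not_le.2 hκ)
end configurations

/-! ### Generalized Vandermonde matrices and the equation of the configuration. -/

section vandermonde
open Polynomial

/-- Erasing the leading term removes at least one monomial and at most one sign variation, and a
single monomial has no variation. Descartes' rule then bounds positive roots by the number of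
monomials. -/
lemma signVariations_add_one_le_card_support {P : ℝ[X]} (hP : P ≠ 0) :
    P.signVariations + 1 ≤ P.support.card := by
  induction h : P.support.card using Nat.strong_induction_on generalizing P with
  | _ k ih =>
    subst h
    have hpos : 0 < P.support.card := Finset.card_pos.2 (by simpa [Finset.nonempty_iff_ne_empty])
    by_cases h0 : P.eraseLead = 0
    · have hmono : P = monomial P.natDegree P.leadingCoeff := by
        conv_lhs => rw [← P.eraseLead_add_monomial_natDegree_leadingCoeff, h0, zero_add]
      rw [hmono, signVariations_monomial, ← hmono]
      omega
    · have h1 := ih _ (eraseLead_support_card_lt hP) h0 rfl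
      have h2 := eraseLead_support_card_lt hP
      have h3 := signVariations_le_eraseLead_succ P
      omega

/-- A nonzero real polynomial has fewer distinct positive roots than monomials. -/
lemma eq_zero_of_card_support_le_of_roots {m : ℕ} {t : Fin m → ℝ} (ht : Function.Injective t)
    (htpos : ∀ j, 0 < t j) {P : ℝ[X]} (hP : P.support.card ≤ m) (hroot : ∀ j, P.eval (t j) = 0) :
    P = 0 := by
  by_contra hne
  have h1 := signVariations_add_one_le_card_support hne
  have h2 := roots_countP_pos_le_signVariations P
  have hle : (Finset.univ.map ⟨t, ht⟩).val ≤ P.roots := by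
    rw [Multiset.le_iff_subset (Finset.nodup _)]
    intro x hx
    simp only [Finset.mem_val, Finset.mem_map, Finset.mem_univ, true_and] at hx
    obtain ⟨j, rfl⟩ := hx
    exact (mem_roots hne).2 (hroot j)
  have h3 := Multiset.countP_le_of_le (0 < ·) hle
  have h4 : (Finset.univ.map ⟨t, ht⟩).val.countP (0 < ·) = m := by
    rw [Multiset.countP_eq_card.2]
    · simp
    · intro x hx
      simp only [Finset.mem_val, Finset.mem_map, Finset.mem_univ, true_and] at hx
      obtain ⟨j, rfl⟩ := hx
      exact htpos j
  omega

/-- Generalized Vandermonde matrices with distinct positive nodes are nonsingular. -/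
lemma eq_zero_of_forall_sum_mul_pow_eq_zero {m : ℕ} {t v : Fin m → ℝ}
    (ht : Function.Injective t) (htpos : ∀ j, 0 < t j) {e : Fin m → ℕ} (he : Function.Injective e)
    (h : ∀ i, ∑ j, v j * t j ^ e i = 0) : v = 0 := by
  by_contra hv
  have hdet : (Matrix.of fun i j => t j ^ e i : Matrix (Fin m) (Fin m) ℝ).det = 0 := by
    refine Matrix.exists_mulVec_eq_zero_iff.1 ⟨v, hv, funext fun i => ?_⟩
    simp only [Matrix.mulVec, dotProduct, Matrix.of_apply, Pi.zero_apply]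
    rw [← h i]
    exact Finset.sum_congr rfl fun j _ => mul_comm _ _
  -- A left kernel vector is the coefficient vector of a polynomial with at most `m` monomials
  -- vanishing at the `m` nodes.
  obtain ⟨w, hw, hwM⟩ := Matrix.exists_vecMul_eq_zero_iff.2 hdet
  set P : ℝ[X] := ∑ i, monomial (e i) (w i) with hP
  have hcoeff : ∀ i, P.coeff (e i) = w i := by
    intro i
    rw [hP, finsetSum_coeff]
    simp only [coeff_monomial, he.eq_iff]
    simp
  have hP0 : P = 0 := by
    refine eq_zero_of_card_support_le_of_roots ht htpos ?_ fun j => ?_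
    · have hsub : P.support ⊆ Finset.univ.image e := by
        intro k hk
        by_contra hk'
        rw [mem_support_iff] at hk
        apply hk
        rw [hP, finsetSum_coeff]
        refine Finset.sum_eq_zero fun i _ => ?_
        rw [coeff_monomial, if_neg]
        rintro rfl
        exact hk' (Finset.mem_image_of_mem _ (Finset.mem_univ _))
      exact (Finset.card_le_card hsub).trans (Finset.card_image_le.trans (by simp))
    · have := congrFun hwM j
      simp only [Matrix.vecMul, dotProduct, Matrix.of_apply, Pi.zero_apply] at this
      rw [hP, eval_finsetSum]
      simpa [eval_monomial] using this
  refine hw (funext fun i => ?_)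
  rw [← hcoeff i, hP0]; simp

lemma eq_zero_of_forall_sum_mul_pow_two_blocks {n : ℕ} {t v : Fin (2 * n) → ℝ}
    (ht : Function.Injective t) (htpos : ∀ j, 0 < t j) {p q : ℕ} (hpq : p + n ≤ q)
    (h₁ : ∀ i < n, ∑ j, v j * t j ^ (p + i) = 0) (h₂ : ∀ i < n, ∑ j, v j * t j ^ (q + i) = 0) :
    v = 0 := by
  refine eq_zero_of_forall_sum_mul_pow_eq_zero ht htpos
    (e := fun i => if (i : ℕ) < n then p + i else q + (i - n)) ?_ fun i => ?_
  · intro i j hij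
    ext
    simp only at hij
    split_ifs at hij <;> omega
  · by_cases hi : (i : ℕ) < n
    · simpa [hi] using h₁ i hi
    · simpa [hi] using h₂ (i - n) (by omega)

/-- The linear map `y ↦ B y` of a Vandermonde block. -/
noncomputable def blockMap {n : ℕ} (a : Fin (2 * n) → ℝ) (η d s : ℕ) :
    EuclideanSpace ℝ (Fin (2 * n)) →ₗ[ℝ] EuclideanSpace ℝ (Fin n) where
  toFun := applyMatrix (vandermondeBlock a η d s)
  map_add' x y := by simp [applyMatrix, Matrix.mulVec_add]
  map_smul' c x := by simp [applyMatrix, Matrix.mulVec_smul]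

lemma blockMap_apply {n : ℕ} (a : Fin (2 * n) → ℝ) (η d s : ℕ)
    (y : EuclideanSpace ℝ (Fin (2 * n))) (i : Fin n) :
    blockMap a η d s y i = ∑ j, (a j ^ η * y j) * (a j ^ d) ^ (s + i) := by
  simp only [blockMap, applyMatrix, LinearMap.coe_mk, AddHom.coe_mk, Matrix.mulVec, dotProduct,
    vandermondeBlock, Matrix.of_apply]
  refine Finset.sum_congr rfl fun j _ => ?_
  rw [pow_add, mul_comm _ d, pow_mul]; ring

variable {n : ℕ} {a : Fin (2 * n) → ℝ} (ha : Function.Injective a) (ha1 : ∀ j, 1 < a j)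
  (η : ℕ) {d : ℕ} (hd : 1 ≤ d)
include ha ha1 hd

lemma eq_zero_of_blockMap_eq_zero {p q : ℕ} (hpq : p + n ≤ q)
    {y : EuclideanSpace ℝ (Fin (2 * n))} (hp : blockMap a η d p y = 0)
    (hq : blockMap a η d q y = 0) : y = 0 := by
  have ht : Function.Injective fun j => a j ^ d := fun i j hij =>
    ha ((pow_left_inj₀ (by linarith [ha1 i]) (by linarith [ha1 j]) (by omega)).1 hij)
  have h := eq_zero_of_forall_sum_mul_pow_two_blocks (v := fun j => a j ^ η * y j) ht
    (fun j => pow_pos (by linarith [ha1 j]) d) hpq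
    (fun i hi => by have := blockMap_apply a η d p y ⟨i, hi⟩; rw [hp] at this; exact this.symm)
    (fun i hi => by have := blockMap_apply a η d q y ⟨i, hi⟩; rw [hq] at this; exact this.symm)
  ext j
  have h1 := congrFun h j
  have h2 : a j ^ η ≠ 0 := pow_ne_zero _ (by linarith [ha1 j])
  simpa [h2] using h1

/-- Subtracting consecutive blocks multiplies the coefficient at node `t_j = a_j ^ d` by `t_j ^ n -
1`, nonzero because `a_j > 1`. The two differences then form a full Vandermonde system. This is what
makes `S` invertible. -/
lemma eq_zero_of_blockMap_eq (hn : 1 ≤ n) {y : EuclideanSpace ℝ (Fin (2 * n))}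
    (h₁ : blockMap a η d 0 y = blockMap a η d n y)
    (h₂ : blockMap a η d n y = blockMap a η d (2 * n) y) : y = 0 := by
  have ht : Function.Injective fun j => a j ^ d := fun i j hij =>
    ha ((pow_left_inj₀ (by linarith [ha1 i]) (by linarith [ha1 j]) (by omega)).1 hij)
  have key : ∀ s, blockMap a η d s y = blockMap a η d (s + n) y → ∀ i < n,
      ∑ j, (((a j ^ d) ^ n - 1) * (a j ^ η * y j)) * (a j ^ d) ^ (s + i) = 0 := by
    intro s hs i hi
    have h3 := congrArg (fun f : EuclideanSpace ℝ (Fin n) => f ⟨i, hi⟩) hs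
    simp only [blockMap_apply] at h3
    rw [eq_comm, ← sub_eq_zero, ← Finset.sum_sub_distrib] at h3
    rw [← h3]
    refine Finset.sum_congr rfl fun j _ => ?_
    rw [show s + n + i = n + (s + i) by ring, pow_add _ n]; ring
  have h := eq_zero_of_forall_sum_mul_pow_two_blocks ht
    (fun j => pow_pos (by linarith [ha1 j]) d) (p := 0) (q := n) (by omega)
    (key 0 (by rwa [zero_add])) (key n (by rwa [← two_mul]))
  ext j
  have h1 := congrFun h j
  have h2 : a j ^ η ≠ 0 := pow_ne_zero _ (by linarith [ha1 j])
  have h3 : (a j ^ d) ^ n - 1 ≠ 0 := by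
    rw [← pow_mul]
    exact (sub_pos.2 (one_lt_pow₀ (ha1 j) (by positivity))).ne'
  simpa [h2, h3] using h1

/-- The Vandermonde configurations are the solutions of one equation `w = S x + P y + Q z` with
invertible coefficients. -/
lemma exists_equation_of_vandermondeBlock (hn : 1 ≤ n) :
    ∃ S P Q : EuclideanSpace ℝ (Fin n) ≃L[ℝ] EuclideanSpace ℝ (Fin n),
      (∀ x, S x + P x + Q x = x) ∧ ∀ x y z w, w = S x + P y + Q z → ∃ v,
        applyMatrix (vandermondeBlock a η d 0) v = y - x ∧
        applyMatrix (vandermondeBlock a η d n) v = z - x ∧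
        applyMatrix (vandermondeBlock a η d (2 * n)) v = w - x := by
  let b₀ := blockMap a η d 0
  let b₁ := blockMap a η d n
  let b₂ := blockMap a η d (2 * n)
  have hinj : Function.Injective (b₀.prod b₁) := by
    rw [← LinearMap.ker_eq_bot, LinearMap.ker_eq_bot']
    intro y hy
    exact eq_zero_of_blockMap_eq_zero ha ha1 η hd (p := 0) (q := n) (by omega)
      (congrArg Prod.fst hy) (congrArg Prod.snd hy)
  let Φ := (b₀.prod b₁).linearEquivOfInjective hinj (by simp [two_mul])
  have hΦ : ∀ y, Φ y = (b₀ y, b₁ y) := fun y => rfl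
  have hΦ₀ : ∀ p, b₀ (Φ.symm p) = p.1 := fun p => by
    have := congrArg Prod.fst (hΦ (Φ.symm p)); rw [Φ.apply_symm_apply] at this; exact this.symm
  have hΦ₁ : ∀ p, b₁ (Φ.symm p) = p.2 := fun p => by
    have := congrArg Prod.snd (hΦ (Φ.symm p)); rw [Φ.apply_symm_apply] at this; exact this.symm
  let P := b₂ ∘ₗ Φ.symm.toLinearMap ∘ₗ LinearMap.inl ℝ _ _
  let Q := b₂ ∘ₗ Φ.symm.toLinearMap ∘ₗ LinearMap.inr ℝ _ _
  have hPQ : ∀ u v, P u + Q v = b₂ (Φ.symm (u, v)) := by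
    intro u v
    simp only [P, Q, LinearMap.comp_apply, LinearEquiv.coe_coe, ← map_add]
    simp
  let S := LinearMap.id - P - Q
  have hPinj : Function.Injective P := by
    rw [← LinearMap.ker_eq_bot, LinearMap.ker_eq_bot']
    intro u hu
    have h0 := eq_zero_of_blockMap_eq_zero ha ha1 η hd (p := n) (q := 2 * n)
      (y := Φ.symm (u, 0)) (by omega) (hΦ₁ _) (by simpa [hu] using (hPQ u 0).symm)
    have := hΦ₀ (u, 0)
    rw [h0, map_zero] at this
    exact this.symm
  have hQinj : Function.Injective Q := by
    rw [← LinearMap.ker_eq_bot, LinearMap.ker_eq_bot']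
    intro u hu
    have h0 := eq_zero_of_blockMap_eq_zero ha ha1 η hd (p := 0) (q := 2 * n)
      (y := Φ.symm (0, u)) (by omega) (hΦ₀ _) (by simpa [hu] using (hPQ 0 u).symm)
    have := hΦ₁ (0, u)
    rw [h0, map_zero] at this
    exact this.symm
  have hSinj : Function.Injective S := by
    rw [← LinearMap.ker_eq_bot, LinearMap.ker_eq_bot']
    intro u hu
    -- `S u = 0` means `u = P u + Q u`: all three blocks take the value `u` at the vector `Φ.symm
    -- (u, u)`.
    have hu' : u = b₂ (Φ.symm (u, u)) := by
      rw [← hPQ]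
      simp only [S, LinearMap.sub_apply, LinearMap.id_apply] at hu
      rwa [sub_sub, sub_eq_zero] at hu
    have h0 := eq_zero_of_blockMap_eq ha ha1 η hd hn (y := Φ.symm (u, u))
      ((hΦ₀ (u, u)).trans (hΦ₁ (u, u)).symm) ((hΦ₁ (u, u)).trans hu')
    rw [h0, map_zero] at hu'
    exact hu'
  refine ⟨(LinearEquiv.ofInjectiveEndo S hSinj).toContinuousLinearEquiv,
    (LinearEquiv.ofInjectiveEndo P hPinj).toContinuousLinearEquiv,
    (LinearEquiv.ofInjectiveEndo Q hQinj).toContinuousLinearEquiv, fun x => ?_,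
    fun x y z w hw => ⟨Φ.symm (y - x, z - x), hΦ₀ _, hΦ₁ _, ?_⟩⟩
  · simp only [S, LinearEquiv.coe_toContinuousLinearEquiv', LinearEquiv.coe_ofInjectiveEndo,
      LinearMap.sub_apply, LinearMap.id_apply]
    abel
  · change b₂ _ = _
    rw [← hPQ, hw]
    simp only [S, LinearEquiv.coe_toContinuousLinearEquiv', LinearEquiv.coe_ofInjectiveEndo,
      LinearMap.sub_apply, LinearMap.id_apply, map_sub]
    abel
end vandermonde

/-! ### Normalization of the measure and of its hypotheses. -/

section reduction
variable {n : ℕ}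

lemma charFun_eq_measureFourier (μ : Measure (EuclideanSpace ℝ (Fin n)))
    (ξ : EuclideanSpace ℝ (Fin n)) :
    charFun μ ξ = measureFourier μ (-(2 * Real.pi)⁻¹ • ξ) := by
  rw [charFun_apply, measureFourier]
  congr 1; ext x
  have := Real.pi_pos
  have e : inner ℝ x ξ = -(2 * Real.pi * inner ℝ x (-(2 * Real.pi)⁻¹ • ξ)) := by
    rw [inner_smul_right]; field_simp
  rw [← Complex.ofReal_neg, ← e]

/-- Only decay of order `1 / 4` is used later, and `β / 2 ≥ 1 / 4`. The factor `7` exceeds the `2 π`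
of the change of Fourier normalization. -/
lemma norm_charFun_le_of_fourierDecay {μ : Measure (EuclideanSpace ℝ (Fin n))} {β C : ℝ}
    (hβ : 1 / 2 ≤ β) (h : FourierDecay μ β C) (ξ : EuclideanSpace ℝ (Fin n)) :
    ‖charFun μ ξ‖ * (1 + ‖ξ‖) ^ (1 / 4 : ℝ) ≤ 7 * C := by
  rw [charFun_eq_measureFourier]
  set ζ := -(2 * Real.pi)⁻¹ • ξ with hζ
  have hπ := Real.pi_pos
  have hξ : ‖ξ‖ = 2 * Real.pi * ‖ζ‖ := by
    rw [hζ, norm_smul, norm_neg, norm_inv, Real.norm_of_nonneg (by positivity)]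
    field_simp
  have h1 : (1 + ‖ξ‖) ^ (1 / 4 : ℝ) ≤ 7 * (1 + ‖ζ‖) ^ (β / 2) := by
    calc (1 + ‖ξ‖) ^ (1 / 4 : ℝ) ≤ (7 * (1 + ‖ζ‖)) ^ (1 / 4 : ℝ) := by
          refine Real.rpow_le_rpow (by positivity) ?_ (by norm_num)
          rw [hξ]
          nlinarith [Real.pi_lt_d2, norm_nonneg ζ]
      _ = 7 ^ (1 / 4 : ℝ) * (1 + ‖ζ‖) ^ (1 / 4 : ℝ) :=
          Real.mul_rpow (by norm_num) (by positivity)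
      _ ≤ _ := by
          refine mul_le_mul (Real.rpow_le_self_of_one_le (by norm_num) (by norm_num))
            (Real.rpow_le_rpow_of_exponent_le ?_ ?_) (by positivity) (by norm_num)
          · linarith [norm_nonneg ζ]
          · linarith
  calc _ ≤ ‖measureFourier μ ζ‖ * (7 * (1 + ‖ζ‖) ^ (β / 2)) := by gcongr
    _ = 7 * (‖measureFourier μ ζ‖ * (1 + ‖ζ‖) ^ (β / 2)) := by ring
    _ ≤ _ := by gcongr; exact h ζ

lemma measure_univ_le_of_fourierDecay {μ : Measure (EuclideanSpace ℝ (Fin n))} [IsFiniteMeasure μ]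
    {β C : ℝ} (h : FourierDecay μ β C) : μ.real Set.univ ≤ C := by
  have := h 0
  rw [measureFourier] at this
  simpa [abs_of_nonneg measureReal_nonneg] using this

/-- A ball of positive mass meets the support at some `z ∈ E` and lies in the open ball of radius `3
r` about `z`. If `3 r ≥ 1`, the bound on the total mass suffices. -/
lemma measure_closedBall_le_of_ballCondition {E : Set (EuclideanSpace ℝ (Fin n))}
    {μ : Measure (EuclideanSpace ℝ (Fin n))} [IsFiniteMeasure μ] {α C : ℝ}
    (hE : μ.support ⊆ E) (hα0 : 0 ≤ α) (hα : α ≤ n) (hμ : μ.real Set.univ ≤ C)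
    (h : BallCondition E μ α C) (x : EuclideanSpace ℝ (Fin n)) (r : ℝ) (hr : 0 < r) :
    μ.real (Metric.closedBall x r) ≤ C * 3 ^ n * r ^ α := by
  have hC : 0 ≤ C := measureReal_nonneg.trans hμ
  have h3 : C * (3 * r) ^ α ≤ C * 3 ^ n * r ^ α := by
    rw [Real.mul_rpow (by norm_num) hr.le, ← mul_assoc]
    gcongr
    rw [← Real.rpow_natCast]
    exact Real.rpow_le_rpow_of_exponent_le (by norm_num) hα
  by_cases hne : (Metric.closedBall x r ∩ μ.support).Nonempty
  · refine le_trans ?_ h3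
    obtain ⟨z, hz, hzs⟩ := hne
    rcases lt_or_ge (3 * r) 1 with h1 | h1
    · have h4 := h z (hE hzs) (3 * r) (by positivity) h1
      rw [div_le_iff₀ (by positivity)] at h4
      refine (measureReal_mono ?_).trans h4
      refine Metric.closedBall_subset_ball' ?_
      rw [Metric.mem_closedBall, dist_comm] at hz
      linarith
    · calc _ ≤ μ.real Set.univ := measureReal_mono (Set.subset_univ _)
        _ ≤ C := hμ
        _ ≤ _ := le_mul_of_one_le_right hC (Real.one_le_rpow h1 hα0)
  · have : μ (Metric.closedBall x r) = 0 := by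
      refine measure_mono_null (fun y hy hys => hne ⟨y, hy, hys⟩) Measure.measure_compl_support
    rw [Measure.real, this, ENNReal.toReal_zero]
    positivity

/-- Normalization and translation to a probability measure whose support contains the origin. -/
lemma exists_normalized_measure {E : Set (EuclideanSpace ℝ (Fin n))}
    {μ : Measure (EuclideanSpace ℝ (Fin n))} [IsFiniteMeasure μ] {α β C δ R : ℝ} (hδ : 0 < δ)
    (hα0 : 0 ≤ α) (hα : α ≤ n) (hβ : 1 / 2 ≤ β) (hR : ∀ x ∈ E, ∀ x' ∈ E, dist x x' ≤ R)
    (hE : μ.support ⊆ E) (hmass : δ ≤ μ.real Set.univ) (hball : BallCondition E μ α C)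
    (hdecay : FourierDecay μ β C) :
    ∃ (m : ProbabilityMeasure (EuclideanSpace ℝ (Fin n))) (x₀ : EuclideanSpace ℝ (Fin n)),
      (m : Measure (EuclideanSpace ℝ (Fin n))) (Metric.closedBall 0 R)ᶜ = 0 ∧
      (∀ x r, 0 < r → (m : Measure (EuclideanSpace ℝ (Fin n))).real (Metric.closedBall x r) ≤
        (C * 3 ^ n + 7 * C) / δ * r ^ α) ∧
      (∀ ξ, ‖charFun (m : Measure (EuclideanSpace ℝ (Fin n))) ξ‖ * (1 + ‖ξ‖) ^ (1 / 4 : ℝ) ≤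
        (C * 3 ^ n + 7 * C) / δ) ∧
      ∀ x ∈ (m : Measure (EuclideanSpace ℝ (Fin n))).support, x + x₀ ∈ E := by
  have hM := measure_univ_le_of_fourierDecay hdecay
  have hC : 0 ≤ C := measureReal_nonneg.trans hM
  have hμpos : 0 < μ.real Set.univ := hδ.trans_le hmass
  have hμ0 : μ ≠ 0 := by rintro rfl; simp at hμpos
  obtain ⟨x₀, hx₀⟩ := Measure.nonempty_support hμ0
  set c : ENNReal := (μ Set.univ)⁻¹ with hc
  have hcr : c.toReal = (μ.real Set.univ)⁻¹ := ENNReal.toReal_inv _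
  have hcδ : c.toReal ≤ δ⁻¹ := by rw [hcr]; exact inv_anti₀ hδ hmass
  have hprob : IsProbabilityMeasure (c • μ) := ⟨by
    rw [Measure.smul_apply, smul_eq_mul, hc,
      ENNReal.inv_mul_cancel (by simpa using hμ0) (measure_ne_top _ _)]⟩
  have hmeas : Measurable fun x : EuclideanSpace ℝ (Fin n) => x + -x₀ := by fun_prop
  have happ : ∀ s, MeasurableSet s → (c • μ).map (fun x => x + -x₀) s =
      c * μ ((fun x => x + -x₀) ⁻¹' s) := fun s hs => by
    rw [Measure.map_apply hmeas hs, Measure.smul_apply, smul_eq_mul]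
  refine ⟨⟨(c • μ).map (fun x => x + -x₀), Measure.isProbabilityMeasure_map hmeas.aemeasurable⟩,
    x₀, ?_, fun x r hr => ?_, fun ξ => ?_, fun x hx => hE ?_⟩
  · rw [ProbabilityMeasure.coe_mk, happ _ Metric.isClosed_closedBall.measurableSet.compl]
    refine mul_eq_zero_of_right _ (measure_mono_null (t := μ.supportᶜ) (fun y hy hys => hy ?_)
      Measure.measure_compl_support)
    rw [mem_closedBall_zero_iff]
    change ‖y + -x₀‖ ≤ R
    rw [← sub_eq_add_neg, ← dist_eq_norm]
    exact hR y (hE hys) x₀ (hE hx₀)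
  · rw [ProbabilityMeasure.coe_mk, Measure.real, happ _ Metric.isClosed_closedBall.measurableSet,
      ENNReal.toReal_mul]
    have e : (fun y => y + -x₀) ⁻¹' Metric.closedBall x r = Metric.closedBall (x + x₀) r := by
      ext y
      simp only [Set.mem_preimage, Metric.mem_closedBall, dist_eq_norm]
      rw [show y + -x₀ - x = y - (x + x₀) by abel]
    rw [e]
    calc _ ≤ δ⁻¹ * (C * 3 ^ n * r ^ α) := by
          gcongr
          exact measure_closedBall_le_of_ballCondition hE hα0 hα hM hball _ r hr
      _ ≤ δ⁻¹ * ((C * 3 ^ n + 7 * C) * r ^ α) := by gcongr; linarith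
      _ = _ := by ring
  · rw [ProbabilityMeasure.coe_mk, charFun_map_add_const, norm_mul, Complex.norm_exp_ofReal_mul_I,
      mul_one, charFun_apply, integral_smul_measure, ← charFun_apply, norm_smul,
      Real.norm_of_nonneg ENNReal.toReal_nonneg, mul_assoc]
    calc _ ≤ δ⁻¹ * (7 * C) := by
          exact mul_le_mul hcδ (norm_charFun_le_of_fourierDecay hβ hdecay ξ) (by positivity)
            (by positivity)
      _ ≤ δ⁻¹ * (C * 3 ^ n + 7 * C) := by
          gcongr
          exact le_add_of_nonneg_left (by positivity)
      _ = _ := by ring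
  · rw [Measure.mem_support_iff_forall] at hx ⊢
    intro U hU
    obtain ⟨W, hWU, hW, hxW⟩ := mem_nhds_iff.1 hU
    have hW' : IsOpen ((fun y => y + x₀) ⁻¹' W) := hW.preimage (by fun_prop)
    have h1 := hx _ (hW'.mem_nhds hxW)
    rw [ProbabilityMeasure.coe_mk, happ _ hW'.measurableSet] at h1
    have e : (fun y => y + -x₀) ⁻¹' ((fun y => y + x₀) ⁻¹' W) = W := by ext y; simp
    rw [e] at h1
    exact (pos_of_mul_pos_right h1 zero_le).trans_le (measure_mono hWU)

end reduction

/-! ### The theorem. -/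

theorem mainTheorem5 (n : ℕ) (hn : 1 ≤ n) (a : Fin (2 * n) → ℝ)
    (ha : Function.Injective a) (ha1 : ∀ j, 1 < a j) (η d : ℕ) (hd : 1 ≤ d)
    (C δ R : ℝ) (hδ : 0 < δ) :
    ∃ ε₀ : ℝ, 0 < ε₀ ∧
      ∀ (α β : ℝ), (n : ℝ) - ε₀ < α → α < n → (n : ℝ) / 2 < β → β < n →
      ∀ (E : Set (EuclideanSpace ℝ (Fin n))) (μ : Measure (EuclideanSpace ℝ (Fin n)))
        [IsFiniteMeasure μ],
        volume E = 0 →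
        (∀ x ∈ E, ∀ x' ∈ E, dist x x' ≤ R) →
        μ.support ⊆ E →
        δ ≤ μ.real Set.univ →
        BallCondition E μ α C →
        FourierDecay μ β C →
        ∃ (x : EuclideanSpace ℝ (Fin n)) (y : EuclideanSpace ℝ (Fin (2 * n))),
          x ∈ E ∧
          x + applyMatrix (vandermondeBlock a η d 0) y ∈ E ∧
          x + applyMatrix (vandermondeBlock a η d n) y ∈ E ∧
          x + applyMatrix (vandermondeBlock a η d (2 * n)) y ∈ E ∧
          applyMatrix (vandermondeBlock a η d 0) y ≠ 0 ∧
          applyMatrix (vandermondeBlock a η d n) y ≠ 0 ∧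
          applyMatrix (vandermondeBlock a η d (2 * n)) y ≠ 0 := by
  have : Nonempty (Fin n) := ⟨⟨0, hn⟩⟩
  have hn' : (1 : ℝ) ≤ n := by exact_mod_cast hn
  obtain ⟨S, P, Q, hS, hrange⟩ := exists_equation_of_vandermondeBlock ha ha1 η hd hn
  -- The sign of `C` is not known before a measure is given; decay at frequency zero later shows `C
  -- ≥ 0` and removes the absolute value.
  obtain ⟨ε, hε, hmain⟩ := exists_solution_in_support S P Q hS (|C * 3 ^ n + 7 * C| / δ) R
    (by positivity)
  simp only [finrank_euclideanSpace_fin] at hmain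
  -- The cap `1` ensures `α > n - 1 ≥ 0`.
  refine ⟨min ε 1, by positivity, fun α β hα hα' hβ _ E μ _ _ hR hE hmass hball hdecay => ?_⟩
  have hα1 : (n : ℝ) - ε < α := by linarith [min_le_left ε 1]
  have hα0 : 0 ≤ α := by linarith [min_le_right ε 1]
  obtain ⟨m, x₀, hm, hmball, hmdecay, hmE⟩ := exists_normalized_measure hδ hα0 hα'.le
    (by linarith) hR hE hmass hball hdecay
  have hC : 0 ≤ C * 3 ^ n + 7 * C := by
    have := measureReal_nonneg.trans (measure_univ_le_of_fourierDecay hdecay)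
    positivity
  rw [abs_of_nonneg hC] at hmain
  obtain ⟨x, hx, y, hy, z, hz, w, hw, he, hyx, hzx, hwx⟩ := hmain α hα1 hα'.le m hm hmball hmdecay
  obtain ⟨v, hv₀, hv₁, hv₂⟩ := hrange x y z w he
  refine ⟨x + x₀, v, hmE x hx, ?_, ?_, ?_, ?_, ?_, ?_⟩
  · rw [hv₀, show x + x₀ + (y - x) = y + x₀ by abel]; exact hmE y hy
  · rw [hv₁, show x + x₀ + (z - x) = z + x₀ by abel]; exact hmE z hz
  · rw [hv₂, show x + x₀ + (w - x) = w + x₀ by abel]; exact hmE w hw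
  · rw [hv₀]; exact sub_ne_zero.2 hyx
  · rw [hv₁]; exact sub_ne_zero.2 hzx
  · rw [hv₂]; exact sub_ne_zero.2 hwx
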